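/- **Conventions.** For a simplicial set $X$ let $e_i : X_n \to X_1$ be induced by the map $[1]\to[n]$ with image $\{i-1,i\}$, and $\Pi : X_n\to X_1$ by the map with image $\{0,n\}$; the spine of $\mathbf x\in X_n$ is $(e_1(\mathbf x),\dots,e_n(\mathbf x))$. A *partial monoid* is a simplicial set with exactly one vertex $v$ whose spine maps $M_n\to (M_1)^n$, $n\ge 1$, are injective; $[x_1|\dots|x_n]$ denotes the simplex with spine $(x_1,\dots,x_n)$ if it exists, $1=s_0(v)$, and a formula $x_1\cdots x_n = z$ means that $[x_1|\dots|x_n]$ exists and $\Pi[x_1|\dots|x_n]=z$. A *partial group* is a partial monoid with an involutive simplicial map $\mathbf u\mapsto \mathbf u^{-1}$, $M\to M^{\mathrm{op}}$, such that for all $\mathbf u\in M_n$, $n\ge1$, the simplex $[\mathbf u^{-1}|\mathbf u]\in M_{2n}$ exists and has product $1$. For simplicial maps $f,g: Y\to X$ of partial groups and $\eta\in X_1$, write $f\xleftarrow{\eta} g$ if there is $F:Y\times\Delta[1]\to X$ with $F|_{Y\times v_0}=f$, $F|_{Y\times v_1}=g$ and $F(1,\iota)=\eta$, where $\iota$ is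 the nondegenerate edge of $\Delta[1]$, from $v_0$ to $v_1$. Put $N(M)=\{\eta\in M_1 : c\xleftarrow{\eta}\mathrm{Id}_M \text{ for some } c: M\to M\}$. A *fibre bundle* with fibre $F$ is a surjective simplicial map $E\to B$ whose pullback along each $\mathbf b:\Delta[n]\to B$ is isomorphic over $\Delta[n]$ to $F\times\Delta[n]$. An *extension* of $H$ by $M$ is a fibre bundle $E\to H$ with fibre $M$; it is displayed as $M\to E\to H$ when an isomorphism of $M$ with the fibre over the vertex is chosen. An *equivalence* of extensions is an isomorphism of total spaces compatible with the maps from $M$ and to $H$. An *$H$-twisting pair for $M$* is a pair of functions $t: H_1\to \mathrm{Aut}(M)$, $\eta: H_2\to N(M)$ such that (1) $t(g)\circ t(h)\xleftarrow{\eta(g,h)} t(gh)$ for all $[g|h]\in H_2$; (2) $t(1)=\mathrm{Id}$ and $\eta(g,1)=1=\eta(1,g)$ for all $g\in H_1$; (3) $t(g)(\eta(h,k))\cdot\eta(g,hk)=\eta(g,h)\cdot\eta(gh,k)$ for all $[g|h|k]\in H_3$. **Theorem 4.4.** Let $M$ and $H$ be partial groups. (a) An $H$-twisting pair $\phi=(t,\eta)$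 for $M$ defines an extension $M\to M\times_\phi H\xrightarrow{\tau} H$ of $H$ by $M$ which is a partial group. Its $1$-simplices are the pairs $(x,g)\in M_1\times H_1$, and $[(x_1,g_1)|\dots|(x_n,g_n)]$ is an $n$-simplex of it if and only if (i) $[g_1|\dots|g_n]\in H_n$, and (ii) $[x_1|t(g_1)(x_2)|(t(g_1)\circ t(g_2))(x_3)|\dots|(t(g_1)\circ\dots\circ t(g_{n-1}))(x_n)]\in M_n$. The product and the inverse are given by $$\Pi[(x,g)|(z,h)]=(x\cdot t(g)(z)\cdot\eta(g,h),\ g\cdot h),\qquad (x,g)^{-1}=(\eta(g^{-1},g)^{-1}\cdot t(g^{-1})(x^{-1}),\ g^{-1}).$$ The projection is $\tau[(x_1,g_1)|\dots|(x_n,g_n)]=[g_1|\dots|g_n]$, and the fibre inclusion is $x\mapsto(x,1)$. (b) For every extension $M\to E\xrightarrow{\rho}H$ there are an $H$-twisting pair $\phi$ for $M$ and an equivalence of extensions from $M\times_\phi H$ to $E$, i.e. an isomorphism $M\times_\phi H\cong E$ that carries $\tau$ to $\rho$ and is compatible with the maps from $M$. In particular, the total space of every extension of partial groups is a partial group. 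-/

import Mathlib

open CategoryTheory MonoidalCategory CartesianMonoidalCategory Simplicial Opposite

universe u

noncomputable section

namespace PartialGroups

/-! ### Spines and products -/

/-- The spine `(e_1(x), …, e_n(x))` of an `n`-simplex, where `e_i` is induced by
`⦋1⦌ → ⦋n⦌` with image `{i - 1, i}` (indices are shifted: `i : Fin n`). -/
def spine {X : SSet.{u}} {n : ℕ} (x : X _⦋n⦌) : Fin n → X _⦋1⦌ :=
  fun i => X.map (SimplexCategory.mkOfSucc i).op x

/-- The product operator `Π : X_n → X_1`, induced by `⦋1⦌ → ⦋n⦌` with image `{0, n}`. -/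
def prodEdge {X : SSet.{u}} {n : ℕ} (x : X _⦋n⦌) : X _⦋1⦌ :=
  X.map (SimplexCategory.diag n).op x

/-- `IsSimplex a` says that the simplex `[a_1|…|a_n]` exists in `X`. -/
def IsSimplex {X : SSet.{u}} {n : ℕ} (a : Fin n → X _⦋1⦌) : Prop :=
  ∃ w : X _⦋n⦌, spine w = a

/-- `HasProd a z` is the meaning of the formula `a_1 ⋅ a_2 ⋅ … ⋅ a_n = z`: the simplex
`[a_1|…|a_n]` exists in `X` and its product is `z`. -/
def HasProd {X : SSet.{u}} {n : ℕ} (a : Fin n → X _⦋1⦌) (z : X _⦋1⦌) : Prop :=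
  ∃ w : X _⦋n⦌, spine w = a ∧ prodEdge w = z

/-! ### Partial groups -/

/-- A partial monoid: a reduced simplicial set with injective spine operators. -/
class IsPartialMonoid (M : SSet.{u}) : Prop where
  reduced : ∃ v : M _⦋0⦌, ∀ w : M _⦋0⦌, w = v
  spine_injective : ∀ n : ℕ, 1 ≤ n →
    Function.Injective (spine : M _⦋n⦌ → (Fin n → M _⦋1⦌))

/-- The unit `1 = s_0(v)`, where `v` is the unique vertex. -/
def unit (M : SSet.{u}) [IsPartialMonoid M] : M _⦋1⦌ :=
  M.σ 0 (IsPartialMonoid.reduced (M := M)).choose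

/-- A partial group: a partial monoid together with an inversion, that is, a simplicial map
`ν : M → Mᵒᵖ` which is an involution and such that, for each `u ∈ M_n` with `n ≥ 1`, the simplex
`[ν(u)|u] ∈ M_{2n}` exists and has product `1`. -/
class PartialGroup (M : SSet.{u}) extends IsPartialMonoid M where
  inversion : M ⟶ M.op
  inversion_inversion : ∀ (n : ℕ) (x : M _⦋n⦌),
    SSet.opObjEquiv (inversion.app _ (SSet.opObjEquiv (inversion.app _ x))) = x
  inversion_mul : ∀ (n : ℕ), 1 ≤ n → ∀ x : M _⦋n⦌,
    HasProd (Fin.append (spine (SSet.opObjEquiv (inversion.app _ x) : M _⦋n⦌)) (spine x))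
      (unit M)

/-- The inverse of a simplex of a partial group. -/
def inverse {M : SSet.{u}} [PartialGroup M] {n : ℕ} (x : M _⦋n⦌) : M _⦋n⦌ :=
  SSet.opObjEquiv (PartialGroup.inversion.app _ x)

/-! ### Homotopies and the normalizer -/

/-- `f ←[η] g`: the edge `η` determines a homotopy from `g` to `f`, that is, there is
`F : Y × Δ[1] → X` which restricts to `f` on `Y × {v_0}` and to `g` on `Y × {v_1}`, and with
`F(1, ι) = η`, where `ι` is the nondegenerate edge of `Δ[1]`. -/
def DeterminesHomotopy {Y X : SSet.{u}} [IsPartialMonoid Y] (f g : Y ⟶ X) (η : X _⦋1⦌) : Prop :=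
  ∃ F : Y ⊗ Δ[1] ⟶ X, SSet.ι₀ ≫ F = f ∧ SSet.ι₁ ≫ F = g ∧
    F.app (op ⦋1⦌) (unit Y, SSet.stdSimplex.objEquiv.symm (𝟙 ⦋1⦌)) = η

/-- The normalizer `N(M)`: the elements that define a homotopy from the identity of `M`
to some endomorphism of `M`. -/
def normalizer (M : SSet.{u}) [IsPartialMonoid M] : Set (M _⦋1⦌) :=
  {η | ∃ c : M ⟶ M, DeterminesHomotopy c (𝟙 M) η}

/-! ### Fibre bundles and extensions -/

/-- `f : E ⟶ B` is a fibre bundle with fibre `F`: it is surjective, and for every simplex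
`b : Δ[n] ⟶ B` the pullback of `f` along `b` is isomorphic over `Δ[n]` to `F × Δ[n]`
(equivalently, `F × Δ[n]` with its projection is such a pullback). -/
structure IsFibreBundle (F : SSet.{u}) {E B : SSet.{u}} (f : E ⟶ B) : Prop where
  surjective : ∀ n : ℕ, Function.Surjective (f.app (op ⦋n⦌))
  locallyTrivial : ∀ (n : ℕ) (b : Δ[n] ⟶ B),
    ∃ a : F ⊗ Δ[n] ⟶ E, IsPullback a (snd F Δ[n]) f b

/-- `ι : M ⟶ E` identifies `M` with the fibre of `ρ : E ⟶ H` over the vertex of `H`. -/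
def IsFibreInclusion {M E H : SSet.{u}} (ι : M ⟶ E) (ρ : E ⟶ H) : Prop :=
  ∀ v : Δ[0] ⟶ H, ∃ p : M ⟶ Δ[0], IsPullback ι p ρ v

/-! ### Twisting pairs -/

/-- An `H`-twisting pair `(t, η)` for `M`. For a 2-simplex `s = [g|h]` of `H` the element
`η(g,h)` is `η s`, with `g = spine s 0`, `h = spine s 1` and `gh = prodEdge s`. For a 3-simplex
`s = [g|h|k]` one has `d_0 s = [h|k]`, `d_1 s = [gh|k]`, `d_2 s = [g|hk]`, `d_3 s = [g|h]`. -/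
structure TwistingPair (H M : SSet.{u}) [IsPartialMonoid H] [IsPartialMonoid M] where
  t : H _⦋1⦌ → Aut M
  η : H _⦋2⦌ → normalizer M
  homotopy : ∀ s : H _⦋2⦌,
    DeterminesHomotopy ((t (spine s 1)).hom ≫ (t (spine s 0)).hom) (t (prodEdge s)).hom (η s)
  t_unit : t (unit H) = Iso.refl M
  η_unit : ∀ s : H _⦋2⦌, spine s 0 = unit H ∨ spine s 1 = unit H → (η s : M _⦋1⦌) = unit M
  cocycle : ∀ s : H _⦋3⦌, ∃ z : M _⦋1⦌,
    HasProd ![(t (spine s 0)).hom.app _ (η (H.δ 0 s) : M _⦋1⦌), (η (H.δ 2 s) : M _⦋1⦌)] z ∧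
    HasProd ![(η (H.δ 3 s) : M _⦋1⦌), (η (H.δ 1 s) : M _⦋1⦌)] z

namespace TwistingPair

variable {H M : SSet.{u}} [IsPartialMonoid H] [IsPartialMonoid M] (φ : TwistingPair H M)

/-- The function `t(g)` on the elements of `M`. -/
def act (g : H _⦋1⦌) (x : M _⦋1⦌) : M _⦋1⦌ := (φ.t g).hom.app _ x

/-- The iterate `t(g_1) ∘ t(g_2) ∘ … ∘ t(g_k)` applied to `x`. -/
def actList (l : List (H _⦋1⦌)) (x : M _⦋1⦌) : M _⦋1⦌ := l.foldr φ.act x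

/-- For `g = (g_1, …, g_n)` and `x = (x_1, …, x_n)`, the word
`(x_1, t(g_1)(x_2), (t(g_1) ∘ t(g_2))(x_3), …, (t(g_1) ∘ … ∘ t(g_{n-1}))(x_n))`. -/
def word {n : ℕ} (g : Fin n → H _⦋1⦌) (x : Fin n → M _⦋1⦌) : Fin n → M _⦋1⦌ :=
  fun k => φ.actList (List.ofFn fun i : Fin k.val => g (i.castLE k.isLt.le)) (x k)

/-- An `n`-simplex of `M ×_φ H`, given by the labels `(fib e, g_e) ∈ M_1 × H_1` of all edges
`e : ⦋1⦌ ⟶ ⦋n⦌` of the standard `n`-simplex, where `g_e` is the corresponding edge of a simplex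
`base` of `H`. Degenerate edges have label `(1, 1)`; the labels of the edges of every 2-simplex
of `Δ[n]` multiply by the rule `(x,g)(z,h) = (x ⋅ t(g)(z) ⋅ η(g,h), gh)`; and for every simplex
`θ` of `Δ[n]` the word of `M` attached to the labels of its spine is a simplex of `M`. -/
@[ext]
structure Simplex (n : SimplexCategory) where
  base : H.obj (op n)
  fib : (⦋1⦌ ⟶ n) → M _⦋1⦌
  fib_const : ∀ i : ⦋0⦌ ⟶ n, fib (SimplexCategory.σ 0 ≫ i) = unit M
  fib_mul : ∀ θ : ⦋2⦌ ⟶ n,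
    HasProd ![fib (SimplexCategory.mkOfSucc 0 ≫ θ),
      φ.act (spine (H.map θ.op base) 0) (fib (SimplexCategory.mkOfSucc 1 ≫ θ)),
      (φ.η (H.map θ.op base) : M _⦋1⦌)] (fib (SimplexCategory.diag 2 ≫ θ))
  fib_word : ∀ (m : ℕ) (θ : ⦋m⦌ ⟶ n),
    IsSimplex (φ.word (spine (H.map θ.op base))
      (fun i => fib (SimplexCategory.mkOfSucc i ≫ θ)))

/-- The simplicial operators: restriction of the labels. -/
def Simplex.restrict {φ : TwistingPair H M} {n m : SimplexCategory} (s : φ.Simplex n)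
    (α : m ⟶ n) : φ.Simplex m where
  base := H.map α.op s.base
  fib e := s.fib (e ≫ α)
  fib_const i := by simpa using s.fib_const (i ≫ α)
  fib_mul θ := by simpa using s.fib_mul (θ ≫ α)
  fib_word k θ := by simpa using s.fib_word k (θ ≫ α)

/-- The twisted product `M ×_φ H`. -/
def product : SSet.{u} where
  obj n := φ.Simplex n.unop
  map α := ↾fun s => s.restrict α.unop
  map_id _ := by
    ext s
    · simp [Simplex.restrict]
    · simp [Simplex.restrict]
  map_comp _ _ := by
    ext s
    · simp [Simplex.restrict]
    · simp [Simplex.restrict]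

/-- The projection `M ×_φ H ⟶ H`. -/
def proj : φ.product ⟶ H where
  app _ := ↾fun s => Simplex.base s
  naturality _ _ _ := rfl

/-- `t(1) = id` acts trivially. -/
theorem actList_unit (φ : TwistingPair H M) (l : List (H _⦋1⦌)) (hl : ∀ g ∈ l, g = unit H)
    (x : M _⦋1⦌) : φ.actList l x = x := by
  induction l with
  | nil => rfl
  | cons g l ih =>
    have h1 : g = unit H := hl g (by simp)
    have h2 : φ.actList l x = x := ih fun a ha => hl a (by simp [ha])
    change φ.act g (φ.actList l x) = x
    rw [h2, h1, act, φ.t_unit]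
    rfl

/-- All edges of the degenerate simplices on the vertex are `1`. -/
theorem map_const_vertex {n : SimplexCategory} (e : ⦋1⦌ ⟶ n) (i : Fin 1) :
    H.map e.op (H.map (n.const ⦋0⦌ i).op (IsPartialMonoid.reduced (M := H)).choose) = unit H := by
  rw [← Functor.map_comp_apply, ← op_comp]
  have : e ≫ n.const ⦋0⦌ i = SimplexCategory.σ 0 := by
    ext j; exact congrArg Fin.val (Subsingleton.elim (α := Fin 1) _ _)
  rw [this]
  rfl

/-- The fibre inclusion `M ⟶ M ×_φ H`, sending `[x_1|…|x_n]` to `[(x_1,1)|…|(x_n,1)]`. -/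
def incl : M ⟶ φ.product where
  app n := ↾fun y =>
    { base := H.map (n.unop.const ⦋0⦌ 0).op (IsPartialMonoid.reduced (M := H)).choose
      fib := fun e => M.map e.op y
      fib_const := fun i => by
        have : M.map i.op y = (IsPartialMonoid.reduced (M := M)).choose :=
          (IsPartialMonoid.reduced (M := M)).choose_spec _
        rw [op_comp, Functor.map_comp_apply, this]
        rfl
      fib_mul := fun θ => by
        refine ⟨M.map (SimplexCategory.σ 2 ≫ θ).op y, ?_, ?_⟩
        · have hb : ∀ k, spine (H.map θ.op (H.map (n.unop.const ⦋0⦌ 0).op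
              (IsPartialMonoid.reduced (M := H)).choose)) k = unit H := fun k => by
            simp only [spine]
            rw [← Functor.map_comp_apply, ← op_comp]
            exact map_const_vertex _ _
          funext k
          fin_cases k
          · change M.map (SimplexCategory.mkOfSucc 0).op (M.map _ y) = M.map _ y
            rw [← Functor.map_comp_apply, ← op_comp, ← Category.assoc,
              show (SimplexCategory.mkOfSucc 0 : ⦋1⦌ ⟶ ⦋3⦌) ≫ SimplexCategory.σ 2 =
                (SimplexCategory.mkOfSucc 0 : ⦋1⦌ ⟶ ⦋2⦌) by ext j; fin_cases j <;> rfl]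
          · change M.map _ (M.map _ y) = φ.act _ _
            rw [hb, act, φ.t_unit]
            change M.map (SimplexCategory.mkOfSucc 1).op (M.map _ y) = M.map _ y
            rw [← Functor.map_comp_apply, ← op_comp, ← Category.assoc,
              show (SimplexCategory.mkOfSucc 1 : ⦋1⦌ ⟶ ⦋3⦌) ≫ SimplexCategory.σ 2 =
                (SimplexCategory.mkOfSucc 1 : ⦋1⦌ ⟶ ⦋2⦌) by ext j; fin_cases j <;> rfl]
          · change M.map _ (M.map _ y) = (φ.η _ : M _⦋1⦌)
            rw [φ.η_unit _ (Or.inl (hb 0)), ← Functor.map_comp_apply, ← op_comp,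
              ← Category.assoc]
            have h3 : (SimplexCategory.mkOfSucc 2 : ⦋1⦌ ⟶ ⦋3⦌) ≫ SimplexCategory.σ 2 =
                SimplexCategory.σ 0 ≫ (⦋0⦌ : SimplexCategory).const ⦋2⦌ 2 := by
              ext j; fin_cases j <;> rfl
            have h4 : M.map ((⦋0⦌ : SimplexCategory).const ⦋2⦌ 2 ≫ θ).op y =
                (IsPartialMonoid.reduced (M := M)).choose :=
              (IsPartialMonoid.reduced (M := M)).choose_spec _
            change M.map ((SimplexCategory.mkOfSucc 2 ≫ SimplexCategory.σ 2) ≫ θ).op y = _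
            rw [h3, Category.assoc, op_comp, Functor.map_comp_apply, h4]
            rfl
        · rw [prodEdge, ← Functor.map_comp_apply, ← op_comp, ← Category.assoc,
            show SimplexCategory.diag 3 ≫ SimplexCategory.σ 2 = SimplexCategory.diag 2 by
              ext j; fin_cases j <;> rfl]
      fib_word := fun m θ => by
        refine ⟨M.map θ.op y, ?_⟩
        funext k
        rw [word, actList_unit]
        · simp [spine]
        · intro g hg
          simp only [List.mem_ofFn] at hg
          obtain ⟨i, rfl⟩ := hg
          simp only [spine]
          rw [← Functor.map_comp_apply, ← op_comp]
          exact map_const_vertex _ _ }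
  naturality _ _ α := by
    ext y
    apply Simplex.ext
    · change H.map _ _ = H.map _ (H.map _ _)
      rw [← Functor.map_comp_apply]
      rfl
    · funext e
      change M.map _ (M.map _ y) = M.map (e ≫ α.unop).op y
      rw [← Functor.map_comp_apply]
      rfl

/-- The pair `(x, g) ∈ M_1 × H_1` that labels a 1-simplex of `M ×_φ H`. -/
def label (s : φ.product _⦋1⦌) : M _⦋1⦌ × H _⦋1⦌ :=
  (Simplex.fib s (𝟙 ⦋1⦌), Simplex.base s)

end TwistingPair

end PartialGroups

end

open PartialGroups

/-!
A simplex of a partial monoid is determined by its edges, so everything here is expressed through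
edges `e : ⦋1⦌ ⟶ ⦋n⦌`. In a partial group every simplex extends to a *coherent* family of elements
`x i j` (`coherent_edgeBetween`): any sequence of its vertices, in any order and with repetitions,
spans a simplex. This follows by iterating the mirror `[w⁻¹|w]`, and it means that simplices of a
partial group can be permuted, restricted and reversed freely.

A homotopy `F : M × Δ[1] → M` from the identity to an automorphism `α` prolongs a coherent family
on `V` to one on `V × Bool`. Hence the element `η = F(1, ι)` can be multiplied with every simplex
of `M`, and `α` is conjugation by `η`. These elements form a group `Inner M` on which `Aut M` acts,
and coherence is preserved by the gauge transformations `x i j ↦ a i ⋅ x i j ⋅ (a j)⁻¹` with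
`a i` in `Inner M` (`Coherent.gauge`). Computations with twisting pairs thereby become computations
in an honest group, in which the cocycle condition is `TwistingPair.inner_cocycle`.

A trivialization over a simplex `b` of `H` of a bundle with fibre `M` and a chosen section `s` over
the edges is described by automorphisms `τ i` and inner elements `u e` with
`η(g, h) = τ 0 (u 01 ⋅ u 12 ⋅ (u 02)⁻¹)` on 2-simplices (`TwistingPair.Gauge`). In it, the simplices
of the twisted product over `b` correspond to the simplices of `M` by a gauge transformation
followed by the `τ i`, and conditions (i), (ii) on spines are what this correspondence gives.

For part (a), the cocycle condition says exactly that `u (i, j) = η(o → i → j)` and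
`τ i = t(o → i)⁻¹` define such a trivialization for any base vertex `o` (`starGauge`). So the
twisted product is a bundle. As the star does not need its vertices to be in order, coherent
families in `H` and `M` give coherent families in the twisted product, which is therefore a
partial group (`nonempty_partialGroup_of_coherent`).

For part (b), choose over each edge `g` a trivialization that agrees with the fibre inclusion at
the last vertex; at the first vertex the two differ by `t(g)`, and the edge `(1, ι)` is a section
`s(g)`. Comparing these with a trivialization over a simplex `b` gives `τ` and `u` as above
(`nonempty_localTrivialization`), and `τ 0 (u 01 ⋅ u 12 ⋅ (u 02)⁻¹)` is intrinsic because it is the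
element `η(g, h)` with `s(g) ⋅ s(h) = η(g, h) ⋅ s(gh)` (`LocalTrivialization.prodEdge_eq_twist`).
The cocycle condition is then an identity in the group `Inner M`, and the isomorphism from the
twisted product sends `(x, g)` to `x ⋅ s(g)`. The total space is a partial group by transport.
-/

noncomputable section

namespace PartialGroups

/-! ### Simplices determined by their edges -/

/-- The first vertex of an edge of the standard simplex. -/
def src {n : ℕ} (e : ⦋1⦌ ⟶ ⦋n⦌) : Fin (n + 1) := e.toOrderHom (0 : Fin 2)

/-- The last vertex of an edge of the standard simplex. -/
def tgt {n : ℕ} (e : ⦋1⦌ ⟶ ⦋n⦌) : Fin (n + 1) := e.toOrderHom (1 : Fin 2)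

/-- The vertex map of a morphism of the simplex category. -/
def vert {m n : ℕ} (θ : ⦋m⦌ ⟶ ⦋n⦌) : Fin (m + 1) → Fin (n + 1) := θ.toOrderHom

theorem src_le_tgt {n : ℕ} (e : ⦋1⦌ ⟶ ⦋n⦌) : src e ≤ tgt e :=
  e.toOrderHom.monotone (show (0 : Fin 2) ≤ 1 by decide)

theorem vert_monotone {m n : ℕ} (θ : ⦋m⦌ ⟶ ⦋n⦌) : Monotone (vert θ) := θ.toOrderHom.monotone

theorem src_comp {m n : ℕ} (e : ⦋1⦌ ⟶ ⦋m⦌) (θ : ⦋m⦌ ⟶ ⦋n⦌) : src (e ≫ θ) = vert θ (src e) := rfl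

theorem tgt_comp {m n : ℕ} (e : ⦋1⦌ ⟶ ⦋m⦌) (θ : ⦋m⦌ ⟶ ⦋n⦌) : tgt (e ≫ θ) = vert θ (tgt e) := rfl

theorem edge_hom_ext {n : ℕ} {e e' : ⦋1⦌ ⟶ ⦋n⦌} (h₀ : src e = src e') (h₁ : tgt e = tgt e') :
    e = e' :=
  SimplexCategory.Hom.ext_one_left _ _ h₀ h₁

theorem eq_mkOfLe {n : ℕ} (e : ⦋1⦌ ⟶ ⦋n⦌) :
    e = SimplexCategory.mkOfLe (src e) (tgt e) (src_le_tgt e) :=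
  edge_hom_ext rfl rfl

theorem map_map {X : SSet.{u}} {a b c : SimplexCategory} (f : a ⟶ b) (g : b ⟶ c)
    (x : X.obj (op c)) : X.map f.op (X.map g.op x) = X.map (f ≫ g).op x := by
  rw [op_comp, Functor.map_comp_apply]

theorem spine_map {X : SSet.{u}} {m n : ℕ} (θ : ⦋m⦌ ⟶ ⦋n⦌) (w : X _⦋n⦌) (i : Fin m) :
    spine (X.map θ.op w) i = X.map (SimplexCategory.mkOfSucc i ≫ θ).op w := map_map _ _ _

theorem prodEdge_map {X : SSet.{u}} {m n : ℕ} (θ : ⦋m⦌ ⟶ ⦋n⦌) (w : X _⦋n⦌) :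
    prodEdge (X.map θ.op w) = X.map (SimplexCategory.diag m ≫ θ).op w := map_map _ _ _

theorem map_app {X Y : SSet.{u}} (f : X ⟶ Y) {a b : SimplexCategory} (g : a ⟶ b)
    (x : X.obj (op b)) : f.app _ (X.map g.op x) = Y.map g.op (f.app _ x) :=
  NatTrans.naturality_apply f g.op x

theorem spine_app {X Y : SSet.{u}} (f : X ⟶ Y) {n : ℕ} (w : X _⦋n⦌) (i : Fin n) :
    spine (f.app _ w) i = f.app _ (spine w i) := (map_app f _ w).symm

theorem prodEdge_app {X Y : SSet.{u}} (f : X ⟶ Y) {n : ℕ} (w : X _⦋n⦌) :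
    prodEdge (f.app _ w) = f.app _ (prodEdge w) := (map_app f _ w).symm

theorem HasProd.app {X Y : SSet.{u}} (f : X ⟶ Y) {n : ℕ} {a : Fin n → X _⦋1⦌} {z : X _⦋1⦌}
    (h : HasProd a z) : HasProd (fun i => f.app _ (a i)) (f.app _ z) := by
  obtain ⟨w, rfl, rfl⟩ := h
  exact ⟨f.app _ w, funext fun i => spine_app f w i, prodEdge_app f w⟩

theorem IsSimplex.app {X Y : SSet.{u}} (f : X ⟶ Y) {n : ℕ} {a : Fin n → X _⦋1⦌}
    (h : IsSimplex a) : IsSimplex (fun i => f.app (op ⦋1⦌) (a i)) := by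
  obtain ⟨w, rfl⟩ := h
  exact ⟨f.app _ w, funext fun i => spine_app f w i⟩

theorem sset_hom_ext {X Y : SSet.{u}} {f g : X ⟶ Y}
    (h : ∀ (n : ℕ) (x : X _⦋n⦌), f.app _ x = g.app _ x) : f = g := by
  ext n z
  induction n using Opposite.rec with | _ n => ?_
  induction n using SimplexCategory.rec with | _ n => ?_
  exact h n z

section PartialMonoid

variable {X : SSet.{u}} [IsPartialMonoid X]

theorem vertex_eq (v w : X _⦋0⦌) : v = w := by
  obtain ⟨x, hx⟩ := IsPartialMonoid.reduced (M := X)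
  rw [hx v, hx w]

theorem spine_ext {n : ℕ} (hn : 1 ≤ n) {w w' : X _⦋n⦌} (h : ∀ i, spine w i = spine w' i) :
    w = w' :=
  IsPartialMonoid.spine_injective n hn (funext h)

theorem edge_ext {n : ℕ} {w w' : X _⦋n⦌}
    (h : ∀ e : ⦋1⦌ ⟶ ⦋n⦌, X.map e.op w = X.map e.op w') : w = w' := by
  rcases Nat.eq_zero_or_pos n with rfl | hn
  · exact vertex_eq _ _
  · exact spine_ext hn fun i => h _

theorem HasProd.unique {n : ℕ} (hn : 1 ≤ n) {a : Fin n → X _⦋1⦌} {z z' : X _⦋1⦌}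
    (h : HasProd a z) (h' : HasProd a z') : z = z' := by
  obtain ⟨w, hw, rfl⟩ := h
  obtain ⟨w', hw', rfl⟩ := h'
  rw [IsPartialMonoid.spine_injective n hn (hw.trans hw'.symm)]

theorem map_const_eq_unit {n : ℕ} (w : X _⦋n⦌) {e : ⦋1⦌ ⟶ ⦋n⦌} (h : src e = tgt e) :
    X.map e.op w = unit X := by
  have : e = SimplexCategory.σ 0 ≫ (⦋0⦌ : SimplexCategory).const ⦋n⦌ (src e) :=
    edge_hom_ext rfl h.symm
  rw [this, ← map_map]
  exact congrArg (X.σ 0) (vertex_eq _ _)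

theorem app_unit {Y : SSet.{u}} [IsPartialMonoid Y] (f : X ⟶ Y) :
    f.app _ (unit X) = unit Y := by
  unfold unit
  exact (map_app f _ _).trans (congrArg (Y.σ 0) (vertex_eq _ _))

/-- A map into a partial monoid is determined by its effect on edges. -/
theorem hom_ext_edge {Z : SSet.{u}} {f g : Z ⟶ X}
    (h : ∀ z : Z _⦋1⦌, f.app _ z = g.app _ z) : f = g := by
  refine sset_hom_ext fun n z => edge_ext fun e => ?_
  rw [← map_app, ← map_app]
  exact h _

/-- A function on edges extends to a simplicial map into a partial monoid as soon as it sends the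
edges of each simplex to the edges of some simplex. -/
theorem exists_hom_of_edges {Z : SSet.{u}} (Φ : Z _⦋1⦌ → X _⦋1⦌)
    (hΦ : ∀ (n : ℕ) (z : Z _⦋n⦌), ∃ w : X _⦋n⦌, ∀ e : ⦋1⦌ ⟶ ⦋n⦌,
      X.map e.op w = Φ (Z.map e.op z)) :
    ∃ F : Z ⟶ X, ∀ z : Z _⦋1⦌, F.app _ z = Φ z := by
  choose W hW using hΦ
  refine ⟨{ app := fun n => ↾fun z => W n.unop.len z, naturality := ?_ }, ?_⟩
  · intro n m f
    induction n using Opposite.rec with | _ n => ?_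
    induction n using SimplexCategory.rec with | _ n => ?_
    induction m using Opposite.rec with | _ m => ?_
    induction m using SimplexCategory.rec with | _ m => ?_
    ext z
    refine edge_ext (n := m) fun e => ?_
    change X.map e.op (W m (Z.map f z)) = X.map e.op (X.map f.unop.op (W n z))
    rw [hW, map_map, hW, ← map_map]
    rfl
  · intro z
    have := hW 1 z (𝟙 _)
    rw [op_id, Functor.map_id_apply, Functor.map_id_apply] at this
    exact this

end PartialMonoid

/-! ### Coherent families of edges -/

/-- A family of elements `x i j` indexed by pairs of elements of `V` is coherent if every finite
sequence `θ` of elements of `V`, in any order and with any repetitions, spans a simplex whose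
edges are the `x (θ i) (θ j)`. -/
def Coherent {X : SSet.{u}} {V : Type} (x : V → V → X _⦋1⦌) : Prop :=
  ∀ (n : ℕ) (θ : Fin (n + 1) → V), ∃ w : X _⦋n⦌, ∀ e : ⦋1⦌ ⟶ ⦋n⦌,
    X.map e.op w = x (θ (src e)) (θ (tgt e))

namespace Coherent

variable {X : SSet.{u}} {V W : Type} {x : V → V → X _⦋1⦌}

theorem reindex (hx : Coherent x) (f : W → V) : Coherent fun i j => x (f i) (f j) :=
  fun n θ => hx n (f ∘ θ)

theorem app {Y : SSet.{u}} (hx : Coherent x) (f : X ⟶ Y) :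
    Coherent fun i j => f.app (op ⦋1⦌) (x i j) := fun n θ => by
  obtain ⟨w, hw⟩ := hx n θ
  refine ⟨f.app _ w, fun e => ?_⟩
  rw [← map_app, hw]

/-- The simplex of a coherent family on a sequence of vertices. -/
def simplex (hx : Coherent x) {n : ℕ} (θ : Fin (n + 1) → V) : X _⦋n⦌ := (hx n θ).choose

theorem map_simplex_edge (hx : Coherent x) {n : ℕ} (θ : Fin (n + 1) → V) (e : ⦋1⦌ ⟶ ⦋n⦌) :
    X.map e.op (hx.simplex θ) = x (θ (src e)) (θ (tgt e)) := (hx n θ).choose_spec e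

theorem spine_simplex (hx : Coherent x) {n : ℕ} (θ : Fin (n + 1) → V) (i : Fin n) :
    spine (hx.simplex θ) i = x (θ i.castSucc) (θ i.succ) := hx.map_simplex_edge θ _

theorem prodEdge_simplex (hx : Coherent x) {n : ℕ} (θ : Fin (n + 1) → V) :
    prodEdge (hx.simplex θ) = x (θ 0) (θ (Fin.last n)) := hx.map_simplex_edge θ _

theorem isSimplex (hx : Coherent x) {n : ℕ} (θ : Fin (n + 1) → V) :
    IsSimplex fun i : Fin n => x (θ i.castSucc) (θ i.succ) :=
  ⟨hx.simplex θ, funext fun i => hx.spine_simplex θ i⟩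

theorem hasProd (hx : Coherent x) {n : ℕ} (θ : Fin (n + 1) → V) :
    HasProd (fun i : Fin n => x (θ i.castSucc) (θ i.succ)) (x (θ 0) (θ (Fin.last n))) :=
  ⟨hx.simplex θ, funext fun i => hx.spine_simplex θ i, hx.prodEdge_simplex θ⟩

theorem hasProd_two (hx : Coherent x) (i j k : V) : HasProd ![x i j, x j k] (x i k) := by
  convert hx.hasProd ![i, j, k] using 1
  · funext a
    fin_cases a <;> rfl
  · rfl

theorem hasProd_three (hx : Coherent x) (i j k l : V) :
    HasProd ![x i j, x j k, x k l] (x i l) := by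
  convert hx.hasProd ![i, j, k, l] using 1
  · funext a
    fin_cases a <;> rfl
  · rfl

variable [IsPartialMonoid X]

theorem self (hx : Coherent x) (i : V) : x i i = unit X :=
  (hx.map_simplex_edge (n := 0) (fun _ => i) (SimplexCategory.σ 0)).symm.trans
    (map_const_eq_unit _ rfl)

theorem map_simplex (hx : Coherent x) {m n : ℕ} (θ : Fin (n + 1) → V) (f : ⦋m⦌ ⟶ ⦋n⦌) :
    X.map f.op (hx.simplex θ) = hx.simplex (fun i => θ (vert f i)) := by
  refine edge_ext fun e => ?_
  rw [map_map, map_simplex_edge, map_simplex_edge, src_comp, tgt_comp]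

end Coherent

/-- A coherent family on the vertices of `Δ[n]` extends a simplex `w` if its increasing edges are
those of `w`. -/
def Extends {X : SSet.{u}} {n : ℕ} (x : Fin (n + 1) → Fin (n + 1) → X _⦋1⦌) (w : X _⦋n⦌) : Prop :=
  ∀ e : ⦋1⦌ ⟶ ⦋n⦌, X.map e.op w = x (src e) (tgt e)

theorem Extends.simplex_eq {X : SSet.{u}} [IsPartialMonoid X] {n m : ℕ}
    {x : Fin (n + 1) → Fin (n + 1) → X _⦋1⦌} {w : X _⦋n⦌} (h : Extends x w) (hx : Coherent x)
    (θ : ⦋m⦌ ⟶ ⦋n⦌) : hx.simplex (vert θ) = X.map θ.op w := by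
  refine edge_ext fun e => ?_
  rw [hx.map_simplex_edge, map_map, h, src_comp, tgt_comp]

/-! ### Partial groups: every simplex extends to a coherent family -/

theorem map_edge_one {X : SSet.{u}} {a : X _⦋1⦌} {e : ⦋1⦌ ⟶ ⦋1⦌} (h₀ : src e = 0) (h₁ : tgt e = 1) :
    X.map e.op a = a := by
  have : e = 𝟙 _ := edge_hom_ext h₀ h₁
  rw [this, op_id, Functor.map_id_apply]

theorem hasProd_map {X : SSet.{u}} {n : ℕ} (w : X _⦋n⦌) {i j k : Fin (n + 1)} (hij : i ≤ j)
    (hjk : j ≤ k) :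
    HasProd ![X.map (SimplexCategory.mkOfLe i j hij).op w,
      X.map (SimplexCategory.mkOfLe j k hjk).op w]
      (X.map (SimplexCategory.mkOfLe i k (hij.trans hjk)).op w) := by
  refine ⟨X.map (SimplexCategory.mkOfLeComp i j k hij hjk).op w, ?_, ?_⟩
  · funext a
    rw [spine_map]
    fin_cases a
    · exact congrArg (fun e : ⦋1⦌ ⟶ ⦋n⦌ => X.map e.op w) (edge_hom_ext rfl rfl)
    · exact congrArg (fun e : ⦋1⦌ ⟶ ⦋n⦌ => X.map e.op w) (edge_hom_ext rfl rfl)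
  · rw [prodEdge_map]
    exact congrArg (fun e : ⦋1⦌ ⟶ ⦋n⦌ => X.map e.op w) (edge_hom_ext rfl rfl)

section PartialMonoid

variable {X : SSet.{u}} [IsPartialMonoid X]

theorem coherent_unit {V : Type} : Coherent fun _ _ : V => unit X := fun n _ =>
  ⟨X.map ((⦋n⦌ : SimplexCategory).const ⦋0⦌ 0).op (IsPartialMonoid.reduced (M := X)).choose,
    fun e => by rw [map_map]; exact map_const_eq_unit _ rfl⟩

theorem hasProd_unit_left (a : X _⦋1⦌) : HasProd ![unit X, a] a := by
  refine ⟨X.σ 0 a, ?_, ?_⟩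
  · funext i
    fin_cases i
    · exact (spine_map (SimplexCategory.σ 0) a 0).trans (map_const_eq_unit _ rfl)
    · exact (spine_map (SimplexCategory.σ 0) a 1).trans (map_edge_one rfl rfl)
  · exact (prodEdge_map (SimplexCategory.σ 0) a).trans (map_edge_one rfl rfl)

theorem hasProd_unit_right (a : X _⦋1⦌) : HasProd ![a, unit X] a := by
  refine ⟨X.σ 1 a, ?_, ?_⟩
  · funext i
    fin_cases i
    · exact (spine_map (SimplexCategory.σ 1) a 0).trans (map_edge_one rfl rfl)
    · exact (spine_map (SimplexCategory.σ 1) a 1).trans (map_const_eq_unit _ rfl)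
  · exact (prodEdge_map (SimplexCategory.σ 1) a).trans (map_edge_one rfl rfl)

end PartialMonoid

section PartialGroup

variable {M : SSet.{u}} [PartialGroup M]

theorem src_rev {n : ℕ} (e : ⦋1⦌ ⟶ ⦋n⦌) :
    src (n := n) (SimplexCategory.rev.map e) = (tgt e).rev := rfl

theorem tgt_rev {n : ℕ} (e : ⦋1⦌ ⟶ ⦋n⦌) :
    tgt (n := n) (SimplexCategory.rev.map e) = (src e).rev := rfl

theorem map_rev_inverse {m n : ℕ} (θ : ⦋m⦌ ⟶ ⦋n⦌) (w : M _⦋n⦌) :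
    M.map (X := op ⦋n⦌) (Y := op ⦋m⦌) (SimplexCategory.rev.map θ).op (inverse w) =
      inverse (M.map θ.op w) :=
  congrArg SSet.opObjEquiv (map_app (PartialGroup.inversion (M := M)) θ w).symm

theorem map_inverse {n : ℕ} (w : M _⦋n⦌) (e : ⦋1⦌ ⟶ ⦋n⦌) :
    M.map e.op (inverse w) =
      inverse (M.map (SimplexCategory.mkOfLe (tgt e).rev (src e).rev
        (Fin.rev_le_rev.2 (src_le_tgt e))).op w) := by
  rw [← map_rev_inverse]
  refine congrArg (fun e : ⦋1⦌ ⟶ ⦋n⦌ => M.map e.op (inverse w)) (edge_hom_ext ?_ ?_)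
  · exact (Fin.rev_rev _).symm
  · exact (Fin.rev_rev _).symm

@[simp]
theorem inverse_inverse {n : ℕ} (w : M _⦋n⦌) : inverse (inverse w) = w :=
  PartialGroup.inversion_inversion n w

@[simp]
theorem inverse_unit : inverse (unit M) = unit M := by
  have := map_rev_inverse (M := M) (m := 1) (n := 0) (SimplexCategory.σ 0)
    (IsPartialMonoid.reduced (M := M)).choose
  exact this.symm.trans (map_const_eq_unit _ rfl)

/-- The mirror `[w⁻¹|w]` of a simplex. -/
theorem exists_mirror {n : ℕ} (hn : 1 ≤ n) (w : M _⦋n⦌) : ∃ W : M _⦋n + n⦌,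
    M.map (SimplexCategory.subinterval 0 n (by omega)).op W = inverse w ∧
    M.map (SimplexCategory.subinterval n n le_rfl).op W = w ∧ prodEdge W = unit M := by
  obtain ⟨W, hW, hW'⟩ := PartialGroup.inversion_mul n hn w
  refine ⟨W, spine_ext hn fun i => ?_, spine_ext hn fun i => ?_, hW'⟩
  · rw [spine_map, SimplexCategory.mkOfSucc_subinterval_eq]
    have := congrFun hW (Fin.castAdd n i)
    rw [Fin.append_left] at this
    refine Eq.trans ?_ this
    refine congrArg (fun k => spine W k) (Fin.ext ?_)
    exact Nat.zero_add _
  · rw [spine_map, SimplexCategory.mkOfSucc_subinterval_eq]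
    have := congrFun hW (Fin.natAdd n i)
    rw [Fin.append_right] at this
    exact this

theorem hasProd_inverse_left (a : M _⦋1⦌) : HasProd ![inverse a, a] (unit M) := by
  obtain ⟨W, h1, h2, h3⟩ := exists_mirror le_rfl a
  refine ⟨W, funext fun i => ?_, h3⟩
  fin_cases i
  · refine Eq.trans ?_ h1
    exact congrArg (fun e : ⦋1⦌ ⟶ ⦋2⦌ => M.map e.op W) (edge_hom_ext rfl rfl)
  · refine Eq.trans ?_ h2
    exact congrArg (fun e : ⦋1⦌ ⟶ ⦋2⦌ => M.map e.op W) (edge_hom_ext rfl rfl)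

/-- The edge of a simplex of a partial group between two vertices in any order. -/
def edgeBetween {n : ℕ} (w : M _⦋n⦌) (i j : Fin (n + 1)) : M _⦋1⦌ :=
  if h : i ≤ j then M.map (SimplexCategory.mkOfLe i j h).op w
  else inverse (M.map (SimplexCategory.mkOfLe j i (le_of_not_ge h)).op w)

theorem edgeBetween_of_le {n : ℕ} (w : M _⦋n⦌) {i j : Fin (n + 1)} (h : i ≤ j) :
    edgeBetween w i j = M.map (SimplexCategory.mkOfLe i j h).op w := dif_pos h

theorem extends_edgeBetween {n : ℕ} (w : M _⦋n⦌) : Extends (edgeBetween w) w := fun e => by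
  rw [edgeBetween_of_le w (src_le_tgt e), ← eq_mkOfLe]

theorem inverse_edgeBetween {n : ℕ} (w : M _⦋n⦌) (i j : Fin (n + 1)) :
    inverse (edgeBetween w i j) = edgeBetween w j i := by
  rcases lt_trichotomy i j with h | rfl | h
  · rw [edgeBetween_of_le w h.le, edgeBetween, dif_neg h.not_ge]
  · rw [edgeBetween_of_le w le_rfl, map_const_eq_unit _ rfl, inverse_unit]
  · rw [edgeBetween_of_le w h.le, edgeBetween, dif_neg h.not_ge, inverse_inverse]

/-- The edges of the mirror `[w⁻¹|w]` are the edges of `w` between the mirrored vertices. -/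
theorem exists_mirror_edges {n : ℕ} (hn : 1 ≤ n) (w : M _⦋n⦌) : ∃ W : M _⦋n + n⦌,
    ∀ p q : Fin (n + n + 1), p ≤ q →
      ∀ a b : Fin (n + 1), (p.val + a.val = n ∨ p.val = n + a.val) →
        (q.val + b.val = n ∨ q.val = n + b.val) → edgeBetween W p q = edgeBetween w a b := by
  obtain ⟨W, h1, h2, -⟩ := exists_mirror hn w
  have front : ∀ p q : Fin (n + n + 1), p ≤ q → ∀ a b : Fin (n + 1), p.val + a.val = n →
      q.val + b.val = n → edgeBetween W p q = edgeBetween w a b := by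
    intro p q hpq a b ha hb
    have hba : b ≤ a := by rw [Fin.le_def] at *; omega
    have hab : a.rev ≤ b.rev := Fin.rev_le_rev.2 hba
    have key := map_inverse w (SimplexCategory.mkOfLe a.rev b.rev hab)
    rw [← h1, map_map] at key
    rw [edgeBetween_of_le W hpq, ← inverse_edgeBetween, edgeBetween_of_le w hba]
    refine Eq.trans ?_ (key.trans ?_)
    · refine congrArg (fun e : ⦋1⦌ ⟶ ⦋n + n⦌ => M.map e.op W)
        (edge_hom_ext (Fin.ext ?_) (Fin.ext ?_))
      · change p.val = (a.rev).val + 0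
        simp only [Fin.val_rev]; omega
      · change q.val = (b.rev).val + 0
        simp only [Fin.val_rev]; omega
    · refine congrArg (fun e : ⦋1⦌ ⟶ ⦋n⦌ => inverse (M.map e.op w)) (edge_hom_ext ?_ ?_)
      · exact Fin.rev_rev _
      · exact Fin.rev_rev _
  have back : ∀ p q : Fin (n + n + 1), p ≤ q → ∀ a b : Fin (n + 1), p.val = n + a.val →
      q.val = n + b.val → edgeBetween W p q = edgeBetween w a b := by
    intro p q hpq a b ha hb
    have hab : a ≤ b := by rw [Fin.le_def] at *; omega
    rw [edgeBetween_of_le W hpq, edgeBetween_of_le w hab]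
    conv_rhs => rw [← h2, map_map]
    refine congrArg (fun e : ⦋1⦌ ⟶ ⦋n + n⦌ => M.map e.op W) (edge_hom_ext (Fin.ext ?_) (Fin.ext ?_))
    · exact ha.trans (Nat.add_comm _ _)
    · exact hb.trans (Nat.add_comm _ _)
  -- the edge between two mirror vertices is trivial, being the product of `[e⁻¹|e]`
  have cross : ∀ p q : Fin (n + n + 1), p ≤ q → ∀ a : Fin (n + 1), p.val + a.val = n →
      q.val = n + a.val → edgeBetween W p q = unit M := by
    intro p q hpq a ha hb
    let c : Fin (n + n + 1) := ⟨n, by omega⟩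
    have hpc : p ≤ c := Fin.le_def.2 (by change _ ≤ n; omega)
    have hcq : c ≤ q := Fin.le_def.2 (by change n ≤ _; omega)
    have := hasProd_map W hpc hcq
    rw [← edgeBetween_of_le, ← edgeBetween_of_le, ← edgeBetween_of_le,
      front p c hpc a 0 ha (by rfl), back c q hcq 0 a (by rfl) hb, ← inverse_edgeBetween] at this
    exact this.unique (by omega) (hasProd_inverse_left _)
  refine ⟨W, fun p q hpq a b ha hb => ?_⟩
  rcases hb with hb | hb
  · rcases ha with ha | ha
    · exact front p q hpq a b ha hb
    · rw [Fin.le_def] at hpq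
      exact front p q hpq a b (by omega) hb
  · rcases ha with ha | ha
    · rcases le_total a b with hab | hab
      · have hab' := Fin.le_def.1 hab
        let c : Fin (n + n + 1) := ⟨n + a.val, by omega⟩
        have hpc : p ≤ c := Fin.le_def.2 (by change _ ≤ n + a.val; omega)
        have hcq : c ≤ q := Fin.le_def.2 (by change n + a.val ≤ _; omega)
        have := hasProd_map W hpc hcq
        rw [← edgeBetween_of_le, ← edgeBetween_of_le, ← edgeBetween_of_le,
          cross p c hpc a ha rfl, back c q hcq a b rfl hb] at this
        exact this.unique (by omega) (hasProd_unit_left _)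
      · have hab' := Fin.le_def.1 hab
        let c : Fin (n + n + 1) := ⟨n - b.val, by omega⟩
        have hc : c.val = n - b.val := rfl
        have hpc : p ≤ c := Fin.le_def.2 (by omega)
        have hcq : c ≤ q := Fin.le_def.2 (by omega)
        have := hasProd_map W hpc hcq
        rw [← edgeBetween_of_le, ← edgeBetween_of_le, ← edgeBetween_of_le,
          cross c q hcq b (by omega) hb, front p c hpc a b ha (by omega)] at this
        exact this.unique (by omega) (hasProd_unit_right _)
    · exact back p q hpq a b ha hb

/-- Every simplex of a partial group extends to a coherent family. A sequence of `L + 1` vertices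
is a subsequence of an iterated mirror of the simplex: its first vertex is found in the
left half of a mirror, the others in the right half. -/
theorem coherent_edgeBetween {n : ℕ} (w : M _⦋n⦌) : Coherent (edgeBetween w) := by
  rcases Nat.eq_zero_or_pos n with rfl | hn
  · have : edgeBetween w = fun _ _ => unit M := by
      funext i j
      have hij : i = j := Subsingleton.elim (α := Fin 1) _ _
      subst hij
      rw [edgeBetween_of_le w le_rfl, map_const_eq_unit _ rfl]
    rw [this]
    exact coherent_unit
  have key : ∀ L : ℕ, ∃ (N : ℕ) (ζ : Fin (N + 1) → Fin (n + 1)) (W : M _⦋N⦌), 1 ≤ N ∧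
      (∀ p q, p ≤ q → edgeBetween W p q = edgeBetween w (ζ p) (ζ q)) ∧
      ∀ θ : Fin (L + 1) → Fin (n + 1), ∃ f : Fin (L + 1) → Fin (N + 1), Monotone f ∧
        ∀ i, ζ (f i) = θ i := by
    intro L
    induction L with
    | zero =>
      exact ⟨n, id, w, hn, fun _ _ _ => rfl, fun θ => ⟨θ, fun i j _ => by
        rw [Subsingleton.elim (α := Fin 1) i j], fun _ => rfl⟩⟩
    | succ L ih =>
      obtain ⟨N, ζ, W, hN, hW, hζ⟩ := ih
      obtain ⟨W', hW'⟩ := exists_mirror_edges hN W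
      -- the position in `W` mirrored to the position `p` of `W'`
      let r : Fin (N + N + 1) → Fin (N + 1) := fun p =>
        if p.val ≤ N then ⟨N - p.val, by omega⟩ else ⟨p.val - N, by omega⟩
      have hr : ∀ p, p.val + (r p).val = N ∨ p.val = N + (r p).val := by
        intro p
        by_cases h : p.val ≤ N
        · left; simp only [r, if_pos h]; omega
        · right; simp only [r, if_neg h]; omega
      have hW2 : ∀ a b, edgeBetween W a b = edgeBetween w (ζ a) (ζ b) := by
        intro a b
        rcases le_total a b with h | h
        · exact hW a b h
        · rw [← inverse_edgeBetween, hW b a h, inverse_edgeBetween]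
      refine ⟨N + N, ζ ∘ r, W', by omega, fun p q hpq => ?_, fun θ => ?_⟩
      · rw [hW' p q hpq (r p) (r q) (hr p) (hr q), hW2]
        rfl
      · obtain ⟨f, hf, hfθ⟩ := hζ fun i => θ i.succ
        obtain ⟨f₀, -, hf₀⟩ := hζ fun _ => θ 0
        refine ⟨Fin.cons ⟨N - (f₀ 0).val, by omega⟩ fun i => ⟨N + (f i).val, by omega⟩, ?_, ?_⟩
        · intro i j
          refine Fin.cases ?_ (fun i => ?_) i
          · refine Fin.cases (fun _ => le_rfl) (fun j _ => ?_) j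
            simp only [Fin.cons_zero, Fin.cons_succ, Fin.le_def]
            omega
          · refine Fin.cases (fun h => ?_) (fun j h => ?_) j
            · exact absurd h (by simp)
            · simp only [Fin.cons_succ, Fin.le_def]
              have := Fin.le_def.1 (hf (Fin.succ_le_succ_iff.1 h))
              omega
        · refine Fin.cases ?_ fun i => ?_
          · simp only [Fin.cons_zero, Function.comp]
            rw [← hf₀ 0]
            refine congrArg ζ (Fin.ext ?_)
            have h0 : (r ⟨N - (f₀ 0).val, by omega⟩).val = N - (N - (f₀ 0).val) := by
              simp only [r, if_pos (Nat.sub_le N (f₀ 0).val)]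
            rw [h0]
            omega
          · simp only [Fin.cons_succ, Function.comp]
            rw [← hfθ i]
            refine congrArg ζ (Fin.ext ?_)
            simp only [r]
            split_ifs
            · change N - (N + (f i).val) = _
              omega
            · change N + (f i).val - N = _
              omega
  intro L θ
  obtain ⟨N, ζ, W, -, hW, hζ⟩ := key L
  obtain ⟨f, hf, hfθ⟩ := hζ θ
  refine ⟨M.map (SimplexCategory.mkHom ⟨f, hf⟩ : ⦋L⦌ ⟶ ⦋N⦌).op W, fun e => ?_⟩
  rw [map_map, extends_edgeBetween W, hW _ _ (src_le_tgt _), src_comp, tgt_comp, ← hfθ, ← hfθ]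
  rfl

theorem edgeBetween_self (x : M _⦋1⦌) : edgeBetween x 0 1 = x :=
  (edgeBetween_of_le x (by decide)).trans (map_edge_one rfl rfl)

theorem edgeBetween_refl {n : ℕ} (x : M _⦋n⦌) (i : Fin (n + 1)) : edgeBetween x i i = unit M :=
  (coherent_edgeBetween x).self i

/-- In a partial group, a factor of a product of two elements is the product of the other factor's
inverse with the product. -/
theorem HasProd.inverse_left {a b c : M _⦋1⦌} (h : HasProd ![a, b] c) :
    HasProd ![inverse a, c] b := by
  obtain ⟨w, hw, rfl⟩ := h
  have h0 : edgeBetween w 0 1 = a :=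
    (edgeBetween_of_le w (by decide)).trans (congrFun hw 0)
  have h1 : edgeBetween w 1 2 = b :=
    (edgeBetween_of_le w (by decide)).trans (congrFun hw 1)
  have h2 : edgeBetween w 0 2 = prodEdge w := edgeBetween_of_le w (by decide)
  rw [← h0, ← h1, ← h2, inverse_edgeBetween]
  exact (coherent_edgeBetween w).hasProd_two _ _ _

theorem HasProd.inverse {a b c : M _⦋1⦌} (h : HasProd ![a, b] c) :
    HasProd ![PartialGroups.inverse b, PartialGroups.inverse a] (PartialGroups.inverse c) := by
  obtain ⟨w, hw, rfl⟩ := h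
  have h0 : edgeBetween w 0 1 = a :=
    (edgeBetween_of_le w (by decide)).trans (congrFun hw 0)
  have h1 : edgeBetween w 1 2 = b :=
    (edgeBetween_of_le w (by decide)).trans (congrFun hw 1)
  have h2 : edgeBetween w 0 2 = prodEdge w := edgeBetween_of_le w (by decide)
  rw [← h0, ← h1, ← h2, inverse_edgeBetween, inverse_edgeBetween, inverse_edgeBetween]
  exact (coherent_edgeBetween w).hasProd_two _ _ _

theorem HasProd.inverse_right {a b c : M _⦋1⦌} (h : HasProd ![a, b] c) :
    HasProd ![c, PartialGroups.inverse b] a := by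
  simpa using h.inverse.inverse_left.inverse

theorem HasProd.right_cancel {a a' b c : M _⦋1⦌} (h : HasProd ![a, b] c)
    (h' : HasProd ![a', b] c) : a = a' :=
  h.inverse_right.unique (by omega) h'.inverse_right

theorem Coherent.inverse {V : Type} {x : V → V → M _⦋1⦌} (hx : Coherent x) (i j : V) :
    inverse (x i j) = x j i := by
  have h := hx.hasProd_two j i j
  rw [hx.self] at h
  exact (hasProd_inverse_left (x i j)).right_cancel h

theorem inverse_app {N : SSet.{u}} [PartialGroup N] (f : M ⟶ N) (a : M _⦋1⦌) :
    f.app _ (inverse a) = inverse (f.app _ a) := by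
  have h := (hasProd_inverse_left a).app f
  rw [app_unit] at h
  refine HasProd.right_cancel (b := f.app _ a) (c := unit N) ?_ (hasProd_inverse_left _)
  convert h using 1
  funext i
  fin_cases i <;> rfl

end PartialGroup

/-! ### Homotopies and inner automorphisms -/

theorem DeterminesHomotopy.precomp {Z Y X : SSet.{u}} [IsPartialMonoid Y] [IsPartialMonoid Z]
    {f g : Y ⟶ X} {η : X _⦋1⦌} (h : DeterminesHomotopy f g η) (k : Z ⟶ Y) :
    DeterminesHomotopy (k ≫ f) (k ≫ g) η := by
  obtain ⟨F, rfl, rfl, rfl⟩ := h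
  refine ⟨k ▷ _ ≫ F, ?_, ?_, ?_⟩
  · rw [← Category.assoc, SSet.ι₀_comp, Category.assoc]
  · rw [← Category.assoc, SSet.ι₁_comp, Category.assoc]
  · change F.app _ (k.app _ (unit Z), _) = _
    rw [app_unit]
    rfl

theorem DeterminesHomotopy.postcomp {Y X Z : SSet.{u}} [IsPartialMonoid Y]
    {f g : Y ⟶ X} {η : X _⦋1⦌} (h : DeterminesHomotopy f g η) (k : X ⟶ Z) :
    DeterminesHomotopy (f ≫ k) (g ≫ k) (k.app _ η) := by
  obtain ⟨F, rfl, rfl, rfl⟩ := h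
  exact ⟨F ≫ k, by rw [Category.assoc], by rw [Category.assoc], rfl⟩

section PartialGroup

variable {M : SSet.{u}} [PartialGroup M]

/-- It suffices to test coherence on sequences of vertices along which a rank function is
monotone, because simplices of a partial group can be permuted. -/
theorem coherent_of_monotone {V α : Type} [LinearOrder α] {x : V → V → M _⦋1⦌} (r : V → α)
    (hinv : ∀ i j, inverse (x i j) = x j i)
    (h : ∀ (n : ℕ) (θ : Fin (n + 1) → V), Monotone (r ∘ θ) →
      ∃ w : M _⦋n⦌, ∀ e : ⦋1⦌ ⟶ ⦋n⦌, M.map e.op w = x (θ (src e)) (θ (tgt e))) :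
    Coherent x := by
  intro n θ
  let s := Tuple.sort (r ∘ θ)
  obtain ⟨w, hw⟩ := h n (θ ∘ s) (Tuple.monotone_sort (r ∘ θ))
  have hw' : edgeBetween w = fun i j => x (θ (s i)) (θ (s j)) := by
    have key : ∀ i j, i ≤ j → edgeBetween w i j = x (θ (s i)) (θ (s j)) := fun i j hij => by
      rw [edgeBetween_of_le w hij, hw]
      rfl
    funext i j
    rcases le_total i j with hij | hij
    · exact key i j hij
    · rw [← inverse_edgeBetween, key j i hij, hinv]
  have hc := (coherent_edgeBetween w).reindex s.symm
  rw [hw'] at hc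
  simp only [Equiv.apply_symm_apply] at hc
  exact hc n id

/-- The family on `V × Bool` with values `c x` over `false`, `x` over `true`, and `L x` from
`false` to `true`. -/
def cylinder {V : Type} (c L : M _⦋1⦌ → M _⦋1⦌) (x : V → V → M _⦋1⦌) :
    V × Bool → V × Bool → M _⦋1⦌ := fun p q =>
  match p, q with
  | (i, false), (j, false) => c (x i j)
  | (i, false), (j, true) => L (x i j)
  | (i, true), (j, false) => inverse (L (x j i))
  | (i, true), (j, true) => x i j

/-- A homotopy to the identity turns a coherent family into a coherent cylinder. -/
theorem coherent_cylinder {c : M ⟶ M} {F : M ⊗ Δ[1] ⟶ M} (h₀ : SSet.ι₀ ≫ F = c)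
    (h₁ : SSet.ι₁ ≫ F = 𝟙 M) {V : Type} {x : V → V → M _⦋1⦌} (hx : Coherent x) :
    Coherent (cylinder (fun y => c.app (op ⦋1⦌) y)
      (fun y => F.app (op ⦋1⦌) (y, SSet.stdSimplex.objEquiv.symm (𝟙 ⦋1⦌))) x) := by
  refine coherent_of_monotone (fun p => p.2) ?_ ?_
  · rintro ⟨i, _ | _⟩ ⟨j, _ | _⟩
    · simp only [cylinder]
      rw [← inverse_app, hx.inverse]
    · rfl
    · exact inverse_inverse _
    · exact hx.inverse i j
  · intro n θ hθ
    obtain ⟨w, hw⟩ := hx n fun i => (θ i).1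
    let σ : ⦋n⦌ ⟶ ⦋1⦌ := SimplexCategory.mkHom ⟨fun i => if (θ i).2 then 1 else 0, fun i j hij => by
      have := hθ hij
      simp only [Function.comp] at this
      rcases h1 : (θ i).2 <;> rcases h2 : (θ j).2 <;> simp_all
      exact absurd this (by decide)⟩
    have hσ : ∀ i, vert σ i = if (θ i).2 then 1 else 0 := fun i => rfl
    refine ⟨F.app (op ⦋n⦌) (w, SSet.stdSimplex.objEquiv.symm σ), fun e => ?_⟩
    refine (map_app F e _).symm.trans ?_
    change F.app (op ⦋1⦌) (M.map e.op w, SSet.stdSimplex.objEquiv.symm (e ≫ σ)) = _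
    rw [hw]
    have hle := hθ (src_le_tgt e)
    have hs := hσ (src e)
    have ht := hσ (tgt e)
    rw [← src_comp] at hs
    rw [← tgt_comp] at ht
    rcases hi : θ (src e) with ⟨i, a⟩
    rcases hj : θ (tgt e) with ⟨j, b⟩
    rw [hi] at hs
    rw [hj] at ht
    simp only [Function.comp, hi, hj] at hle
    rcases a <;> rcases b
    · simp only [cylinder, ← h₀]
      have : e ≫ σ = SimplexCategory.mkOfLe 0 0 le_rfl := edge_hom_ext hs ht
      rw [this]
      change _ = F.app (op ⦋1⦌) _
      refine congrArg (fun s => F.app (op ⦋1⦌) (x i j, s)) ?_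
      ext k
      fin_cases k <;> rfl
    · have : e ≫ σ = 𝟙 _ := edge_hom_ext hs ht
      rw [this]
      rfl
    · exact absurd hle (by decide)
    · have h : x i j = (SSet.ι₁ ≫ F).app (op ⦋1⦌) (x i j) := by rw [h₁]; rfl
      have : e ≫ σ = SimplexCategory.mkOfLe 1 1 le_rfl := edge_hom_ext hs ht
      simp only [cylinder]
      rw [this, h]
      change _ = F.app (op ⦋1⦌) _
      rw [← h]
      refine congrArg (fun s => F.app (op ⦋1⦌) (x i j, s)) ?_
      ext k
      fin_cases k <;> rfl

/-- Conversely, coherent cylinders define a homotopy. -/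
theorem determinesHomotopy_of_cylinder {c : M ⟶ M} {L : M _⦋1⦌ → M _⦋1⦌}
    (h : ∀ (n : ℕ) (x : Fin (n + 1) → Fin (n + 1) → M _⦋1⦌), Coherent x →
      ∃ z : Fin (n + 1) × Bool → Fin (n + 1) × Bool → M _⦋1⦌, Coherent z ∧
        (∀ i j, z (i, false) (j, false) = c.app _ (x i j)) ∧
        (∀ i j, z (i, false) (j, true) = L (x i j)) ∧
        (∀ i j, z (i, true) (j, true) = x i j)) :
    DeterminesHomotopy c (𝟙 M) (L (unit M)) := by
  let Φ : (M ⊗ Δ[1] : SSet.{u}) _⦋1⦌ → M _⦋1⦌ := fun p =>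
    let σ : ⦋1⦌ ⟶ ⦋1⦌ := SSet.stdSimplex.objEquiv p.2
    if tgt σ = 0 then c.app _ p.1 else if src σ = 1 then p.1 else L p.1
  obtain ⟨F, hF⟩ := exists_hom_of_edges Φ (by
    rintro n ⟨w, s⟩
    obtain ⟨z, hz, h1, h2, h3⟩ := h n _ (coherent_edgeBetween w)
    let σ : ⦋n⦌ ⟶ ⦋1⦌ := SSet.stdSimplex.objEquiv s
    obtain ⟨w', hw'⟩ := hz n fun i => (i, decide (vert σ i = 1))
    refine ⟨w', fun e => ?_⟩
    have hw := extends_edgeBetween w e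
    rw [hw']
    change _ = if tgt (e ≫ σ) = 0 then c.app _ (M.map e.op w) else
      if src (e ≫ σ) = 1 then M.map e.op w else L (M.map e.op w)
    rw [src_comp, tgt_comp, hw]
    have hle := vert_monotone σ (src_le_tgt e)
    generalize vert σ (src e) = a at *
    generalize vert σ (tgt e) = b at *
    fin_cases a <;> fin_cases b <;> simp_all)
  exact ⟨F, hom_ext_edge fun x => hF _, hom_ext_edge fun x => hF _, hF _⟩

end PartialGroup

/-- An element `el` of a partial group with an automorphism `aut` such that `el` determines a
homotopy from the identity to `aut`; then `aut` is conjugation by `el`. Multiplication by `el` is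
defined on all simplices, so these elements form a group. -/
structure Inner (M : SSet.{u}) [PartialGroup M] where
  el : M _⦋1⦌
  aut : Aut M
  homotopy : DeterminesHomotopy aut.hom (𝟙 M) el

namespace Inner

variable {M : SSet.{u}} [PartialGroup M]

/-- Left multiplication by an inner element, defined everywhere by the homotopy. -/
def lmul (a : Inner M) (x : M _⦋1⦌) : M _⦋1⦌ :=
  a.homotopy.choose.app (op ⦋1⦌) (x, SSet.stdSimplex.objEquiv.symm (𝟙 ⦋1⦌))

theorem coherent_cylinder (a : Inner M) {V : Type} {x : V → V → M _⦋1⦌} (hx : Coherent x) :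
    Coherent (cylinder (fun y => a.aut.hom.app (op ⦋1⦌) y) a.lmul x) :=
  PartialGroups.coherent_cylinder a.homotopy.choose_spec.1 a.homotopy.choose_spec.2.1 hx

theorem lmul_unit (a : Inner M) : a.lmul (unit M) = a.el := a.homotopy.choose_spec.2.2

theorem hasProd_lmul (a : Inner M) (x : M _⦋1⦌) : HasProd ![a.el, x] (a.lmul x) := by
  have := (a.coherent_cylinder (coherent_edgeBetween x)).hasProd_two (0, false) (0, true) (1, true)
  simpa only [cylinder, edgeBetween_self, edgeBetween_refl, lmul_unit] using this

theorem hasProd_aut (a : Inner M) (x : M _⦋1⦌) :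
    HasProd ![a.aut.hom.app _ x, a.el] (a.lmul x) := by
  have := (a.coherent_cylinder (coherent_edgeBetween x)).hasProd_two (0, false) (1, false) (1, true)
  simpa only [cylinder, edgeBetween_self, edgeBetween_refl, lmul_unit] using this

theorem lmul_eq (a : Inner M) {x y : M _⦋1⦌} (h : HasProd ![a.el, x] y) : a.lmul x = y :=
  (a.hasProd_lmul x).unique (by omega) h

/-- Every homotopy from `1` given by the element `a.el`, and not just the one chosen for `a`, is
left multiplication by `a`. -/
theorem app_eq_lmul {c : M ⟶ M} {F : M ⊗ Δ[1] ⟶ M} (h₀ : SSet.ι₀ ≫ F = c)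
    (h₁ : SSet.ι₁ ≫ F = 𝟙 M) {a : Inner M}
    (ha : F.app (op ⦋1⦌) (unit M, SSet.stdSimplex.objEquiv.symm (𝟙 ⦋1⦌)) = a.el) (x : M _⦋1⦌) :
    F.app (op ⦋1⦌) (x, SSet.stdSimplex.objEquiv.symm (𝟙 ⦋1⦌)) = a.lmul x := by
  have := (PartialGroups.coherent_cylinder h₀ h₁ (coherent_edgeBetween x)).hasProd_two
    (0, false) (0, true) (1, true)
  simp only [cylinder, edgeBetween_self, edgeBetween_refl] at this
  rw [ha] at this
  exact (a.lmul_eq this).symm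

@[ext]
theorem ext {a b : Inner M} (h : a.el = b.el) : a = b := by
  have h2 : a.aut = b.aut := by
    refine Iso.ext (hom_ext_edge fun x => ?_)
    have h1 := a.hasProd_aut x
    have h2 := b.hasProd_aut x
    have h3 : b.lmul x = a.lmul x := b.lmul_eq (h ▸ a.hasProd_lmul x)
    rw [← h3, h] at h1
    exact h1.right_cancel h2
  cases a
  cases b
  simp only at h h2
  subst h h2
  rfl

/-- `a ⋅ (x ⋅ b⁻¹) = (a ⋅ x) ⋅ b⁻¹`: both sides are edges of a double cylinder over `x`. -/
theorem lmul_lmul_commute (a b : Inner M) (x : M _⦋1⦌) :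
    a.lmul (inverse (b.lmul (inverse x))) = inverse (b.lmul (inverse (a.lmul x))) := by
  have hz := b.coherent_cylinder (a.coherent_cylinder (coherent_edgeBetween x))
  refine a.lmul_eq ?_
  have := hz.hasProd_two ((0, false), true) ((0, true), true) ((1, true), false)
  simpa only [cylinder, edgeBetween_self, edgeBetween_refl, lmul_unit, ← inverse_edgeBetween x 0 1]
    using this

instance : One (Inner M) where
  one := ⟨unit M, 1, by
    refine determinesHomotopy_of_cylinder (L := id) fun n x hx =>
      ⟨_, hx.reindex Prod.fst, fun _ _ => rfl, fun _ _ => rfl, fun _ _ => rfl⟩⟩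

/-- The homotopy of a product is the diagonal of the double cylinder. -/
instance : Mul (Inner M) where
  mul a b := ⟨a.lmul b.el, a.aut * b.aut, by
    rw [← b.lmul_unit]
    refine determinesHomotopy_of_cylinder (L := fun x => a.lmul (b.lmul x)) fun n x hx =>
      ⟨_, (a.coherent_cylinder (b.coherent_cylinder hx)).reindex fun p => ((p.1, p.2), p.2),
        fun _ _ => rfl, fun _ _ => rfl, fun _ _ => rfl⟩⟩

/-- The homotopy of an inverse is obtained by reversing the cylinder. -/
instance : Inv (Inner M) where
  inv a := ⟨inverse a.el, a.aut⁻¹, by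
    have h : inverse a.el = inverse (a.lmul (a.aut.inv.app _ (inverse (unit M)))) := by
      rw [inverse_unit, app_unit, lmul_unit]
    rw [h]
    refine determinesHomotopy_of_cylinder
      (L := fun x => inverse (a.lmul (a.aut.inv.app _ (inverse x)))) fun n x hx =>
      ⟨_, (a.coherent_cylinder (hx.app a.aut.inv)).reindex fun p => (p.1, !p.2),
        fun _ _ => rfl, fun i j => ?_, fun i j => ?_⟩
    · simp only [cylinder, Bool.not_false, Bool.not_true]
      rw [hx.inverse]
    · simp only [cylinder, Bool.not_true]
      exact congrArg (fun f : M ⟶ M => f.app _ (x i j)) a.aut.inv_hom_id⟩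

theorem one_el : (1 : Inner M).el = unit M := rfl
theorem mul_el (a b : Inner M) : (a * b).el = a.lmul b.el := rfl
theorem inv_el (a : Inner M) : (a⁻¹).el = inverse a.el := rfl
theorem one_aut : (1 : Inner M).aut = 1 := rfl
theorem mul_aut (a b : Inner M) : (a * b).aut = a.aut * b.aut := rfl
theorem inv_aut (a : Inner M) : (a⁻¹).aut = a.aut⁻¹ := rfl

theorem hasProd_mul (a b : Inner M) : HasProd ![a.el, b.el] (a * b).el := a.hasProd_lmul _

theorem one_lmul (x : M _⦋1⦌) : (1 : Inner M).lmul x = x := lmul_eq _ (hasProd_unit_left x)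

theorem mul_lmul (a b : Inner M) (x : M _⦋1⦌) : (a * b).lmul x = a.lmul (b.lmul x) := by
  have hz := a.coherent_cylinder (b.coherent_cylinder (coherent_edgeBetween x))
  refine lmul_eq _ ?_
  rw [mul_el]
  have := hz.hasProd_two ((0, false), false) ((0, true), true) ((1, true), true)
  simpa only [cylinder, edgeBetween_self, edgeBetween_refl, lmul_unit] using this

instance : Group (Inner M) where
  mul_assoc a b c := ext (mul_lmul a b c.el)
  one_mul a := ext (one_lmul _)
  mul_one a := ext a.lmul_unit
  inv_mul_cancel a := ext (lmul_eq _ (hasProd_inverse_left _))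

/-- The action of automorphisms of `M` on inner elements. -/
instance : MulDistribMulAction (Aut M) (Inner M) where
  smul α a := ⟨α.hom.app _ a.el, α * a.aut * α⁻¹, by
    have := (a.homotopy.precomp α.inv).postcomp α.hom
    rw [Category.comp_id] at this
    change DeterminesHomotopy ((α.inv ≫ a.aut.hom) ≫ α.hom) (α.inv ≫ α.hom) _ at this
    rw [show α.inv ≫ α.hom = 𝟙 M from Iso.inv_hom_id α, Category.assoc] at this
    exact this⟩
  one_smul a := ext rfl
  mul_smul α β a := ext rfl
  smul_mul α a b := ext (by
    refine (lmul_eq _ ?_).symm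
    convert (hasProd_mul a b).app α.hom using 1
    · funext i
      fin_cases i <;> rfl
    · rfl)
  smul_one α := ext (app_unit α.hom)

theorem smul_el (α : Aut M) (a : Inner M) : (α • a).el = α.hom.app _ a.el := rfl
theorem smul_aut (α : Aut M) (a : Inner M) : (α • a).aut = α * a.aut * α⁻¹ := rfl

/-- An inner automorphism acts on inner elements by conjugation. -/
theorem aut_smul (a b : Inner M) : a.aut • b = a * b * a⁻¹ := by
  refine eq_mul_inv_of_mul_eq (ext ?_)
  have h1 : HasProd ![a.aut.hom.app _ b.el, a.el] (a.aut • b * a).el := (a.aut • b).hasProd_mul a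
  exact h1.unique (by omega) (a.hasProd_aut b.el)

/-- The everywhere defined operation `x ↦ a ⋅ x ⋅ b⁻¹`. -/
def bimul (a b : Inner M) (x : M _⦋1⦌) : M _⦋1⦌ := inverse (b.lmul (inverse (a.lmul x)))

theorem bimul_one (x : M _⦋1⦌) : bimul (1 : Inner M) 1 x = x := by
  simp only [bimul, one_lmul, inverse_inverse]

theorem bimul_bimul (a b a' b' : Inner M) (x : M _⦋1⦌) :
    bimul a b (bimul a' b' x) = bimul (a * a') (b * b') x := by
  rw [bimul, bimul, a.lmul_lmul_commute, inverse_inverse, bimul, mul_lmul, mul_lmul]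

theorem bimul_unit (a b : Inner M) : bimul a b (unit M) = (a * b⁻¹).el := by
  rw [bimul, lmul_unit, ← inv_el, ← mul_el, ← inv_el, mul_inv_rev, inv_inv]

theorem bimul_one_right (a : Inner M) (x : M _⦋1⦌) : bimul a 1 x = a.lmul x := by
  rw [bimul, one_lmul, inverse_inverse]

theorem bimul_el (a c : Inner M) : bimul 1 c a.el = (a * c⁻¹).el := by
  rw [← bimul_unit, ← a.lmul_unit, ← bimul_one_right, bimul_bimul, one_mul,
    mul_one]

theorem bimul_self (a : Inner M) (x : M _⦋1⦌) : bimul a a x = a.aut.hom.app _ x := by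
  have h := (a.hasProd_aut x).inverse.inverse_left
  rw [inverse_inverse] at h
  rw [bimul, a.lmul_eq h, inverse_inverse]

theorem coherent_bimul_ite (a : Inner M) {V : Type} {x : V → V → M _⦋1⦌} (hx : Coherent x)
    (S : V → Prop) [DecidablePred S] :
    Coherent fun i j => bimul (if S i then a else 1) (if S j then a else 1) (x i j) := by
  convert (a.coherent_cylinder hx).reindex (fun i => (i, !decide (S i))) using 1
  funext i j
  by_cases hi : S i <;> by_cases hj : S j
  · simpa [hi, hj, cylinder] using a.bimul_self _
  · simp [hi, hj, cylinder, bimul, one_lmul]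
  · simp [hi, hj, cylinder, bimul, one_lmul, hx.inverse]
  · simp [hi, hj, cylinder, bimul, one_lmul]

end Inner

/-- Gauge transformations: coherence is preserved when `x i j` is replaced by
`a i ⋅ x i j ⋅ (a j)⁻¹`. -/
theorem Coherent.gauge {M : SSet.{u}} [PartialGroup M] {V : Type} {x : V → V → M _⦋1⦌}
    (hx : Coherent x) (a : V → Inner M) :
    Coherent fun i j => Inner.bimul (a i) (a j) (x i j) := by
  classical
  intro n θ
  -- the vertices are gauged one at a time
  have key : ∀ S : Finset (Fin (n + 1)), Coherent fun i j : Fin (n + 1) =>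
      Inner.bimul (if i ∈ S then a (θ i) else 1) (if j ∈ S then a (θ j) else 1)
        (x (θ i) (θ j)) := by
    intro S
    induction S using Finset.induction_on with
    | empty =>
      simp only [Finset.notMem_empty, if_false, Inner.bimul_one]
      exact hx.reindex θ
    | insert k S hk ih =>
      have := (a (θ k)).coherent_bimul_ite ih (fun i => i = k)
      simp only [Inner.bimul_bimul] at this
      have h : ∀ i, (if i = k then a (θ k) else 1) * (if i ∈ S then a (θ i) else 1) =
          if i ∈ insert k S then a (θ i) else 1 := by
        intro i
        by_cases hi : i = k
        · subst hi
          simp [hk]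
        · simp [hi]
      simpa only [h] using this
  obtain ⟨w, hw⟩ := key Finset.univ n id
  exact ⟨w, fun e => by simpa using hw e⟩

/-! ### Local trivializations of twisted products -/

namespace TwistingPair

variable {H M : SSet.{u}} [PartialGroup H] [PartialGroup M] (φ : TwistingPair H M)

/-- The element `η s` as an inner element: it is conjugate to the automorphism
`t(g) t(h) t(gh)⁻¹`. -/
def inner (s : H _⦋2⦌) : Inner M where
  el := φ.η s
  aut := φ.t (spine s 0) * φ.t (spine s 1) * (φ.t (prodEdge s))⁻¹
  homotopy := by
    have h := (φ.homotopy s).precomp (φ.t (prodEdge s)).inv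
    rw [show (φ.t (prodEdge s)).inv ≫ (φ.t (prodEdge s)).hom = 𝟙 M from Iso.inv_hom_id _] at h
    exact h

theorem inner_eq_one {s : H _⦋2⦌} (h : spine s 0 = unit H ∨ spine s 1 = unit H) :
    φ.inner s = 1 := Inner.ext (φ.η_unit s h)

theorem inner_cocycle (s : H _⦋3⦌) :
    φ.t (spine s 0) • φ.inner (H.δ 0 s) * φ.inner (H.δ 2 s) =
      φ.inner (H.δ 3 s) * φ.inner (H.δ 1 s) := by
  obtain ⟨z, h1, h2⟩ := φ.cocycle s
  refine Inner.ext (Eq.trans ?_ (h2.unique (by omega)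
    (Inner.hasProd_mul (φ.inner (H.δ 3 s)) (φ.inner (H.δ 1 s)))))
  exact (Inner.hasProd_mul (φ.t (spine s 0) • φ.inner (H.δ 0 s)) _).unique (by omega) h1

theorem actList_eq (l : List (H _⦋1⦌)) (x : M _⦋1⦌) :
    φ.actList l x = ((l.map φ.t).prod).hom.app (op ⦋1⦌) x := by
  induction l with
  | nil => rfl
  | cons g l ih =>
    change φ.act g (φ.actList l x) = _
    rw [ih, List.map_cons, List.prod_cons]
    rfl

/-- A simplex of the twisted product is determined by its base and the labels of its spine. -/
theorem Simplex.ext_spine {φ : TwistingPair H M} {n : ℕ} {s s' : φ.Simplex ⦋n⦌}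
    (hb : s.base = s'.base)
    (hf : ∀ i : Fin n, s.fib (SimplexCategory.mkOfSucc i) = s'.fib (SimplexCategory.mkOfSucc i)) :
    s = s' := by
  have hconst : ∀ (s : φ.Simplex ⦋n⦌) (e : ⦋1⦌ ⟶ ⦋n⦌), src e = tgt e → s.fib e = unit M := by
    intro s e he
    have : e = SimplexCategory.σ 0 ≫ (⦋0⦌ : SimplexCategory).const ⦋n⦌ (src e) :=
      edge_hom_ext rfl he.symm
    rw [this]
    exact s.fib_const _
  have key : ∀ (d : ℕ) (e : ⦋1⦌ ⟶ ⦋n⦌), (tgt e).val = (src e).val + d → s.fib e = s'.fib e := by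
    intro d
    induction d with
    | zero =>
      intro e he
      rw [hconst s e (Fin.ext he.symm), hconst s' e (Fin.ext he.symm)]
    | succ d ih =>
      intro e he
      have hlt : (src e).val + d < n := by
        have := (tgt e).isLt
        omega
      let k : Fin n := ⟨(src e).val + d, hlt⟩
      let θ : ⦋2⦌ ⟶ ⦋n⦌ := SimplexCategory.mkOfLeComp (src e) k.castSucc k.succ
        (Fin.le_def.2 (Nat.le_add_right _ _)) (Fin.castSucc_le_succ k)
      have h1 := s.fib_mul θ
      have h2 := s'.fib_mul θ
      have e0 : SimplexCategory.mkOfSucc 1 ≫ θ = SimplexCategory.mkOfSucc k :=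
        edge_hom_ext rfl rfl
      have e1 : SimplexCategory.diag 2 ≫ θ = e :=
        edge_hom_ext rfl (Fin.ext (by rw [he]; rfl))
      rw [ih (SimplexCategory.mkOfSucc 0 ≫ θ) rfl, e0, e1, hf k, hb] at h1
      rw [e0, e1] at h2
      exact h1.unique (by omega) h2
  refine Simplex.ext hb (funext fun e => key ((tgt e).val - (src e).val) e ?_)
  have := Fin.le_def.1 (src_le_tgt e)
  omega

/-- The data of a trivialization over a simplex `b` of `H`: automorphisms `τ i` comparing `M` with
the fibres over the vertices, and inner elements `u e` measuring the difference between the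
trivialization and the section `g ↦ (1, g)` along the edge `e`. -/
structure Gauge {n : ℕ} (b : H _⦋n⦌) where
  τ : Fin (n + 1) → Aut M
  u : (⦋1⦌ ⟶ ⦋n⦌) → Inner M
  aut_u : ∀ e, (u e).aut = (τ (src e))⁻¹ * φ.t (H.map e.op b) * τ (tgt e)
  inner_eq : ∀ θ : ⦋2⦌ ⟶ ⦋n⦌, φ.inner (H.map θ.op b) =
    τ (vert θ 0) • (u (SimplexCategory.mkOfSucc 0 ≫ θ) * u (SimplexCategory.mkOfSucc 1 ≫ θ) *
      (u (SimplexCategory.diag 2 ≫ θ))⁻¹)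

namespace Gauge

variable {φ} {n : ℕ} {b : H _⦋n⦌} (G : φ.Gauge b)

/-- The restriction of a trivialization to a face or degeneracy of the base. -/
def restrict {m : ℕ} (θ : ⦋m⦌ ⟶ ⦋n⦌) : φ.Gauge (H.map θ.op b) where
  τ i := G.τ (vert θ i)
  u e := G.u (e ≫ θ)
  aut_u e := by
    rw [map_map]
    exact G.aut_u (e ≫ θ)
  inner_eq θ' := by
    rw [map_map]
    exact G.inner_eq (θ' ≫ θ)

theorem u_eq_one {e : ⦋1⦌ ⟶ ⦋n⦌} (he : src e = tgt e) : G.u e = 1 := by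
  let θ : ⦋2⦌ ⟶ ⦋n⦌ := SimplexCategory.mkOfLeComp (src e) (src e) (src e) le_rfl le_rfl
  have h := G.inner_eq θ
  have h0 : spine (H.map θ.op b) 0 = unit H := by
    rw [spine_map]
    exact map_const_eq_unit _ rfl
  rw [φ.inner_eq_one (Or.inl h0), show SimplexCategory.mkOfSucc 0 ≫ θ = e from edge_hom_ext rfl he,
    show SimplexCategory.mkOfSucc 1 ≫ θ = e from edge_hom_ext rfl he,
    show SimplexCategory.diag 2 ≫ θ = e from edge_hom_ext rfl he, mul_inv_cancel_right] at h
  rw [← inv_smul_smul (G.τ (vert θ 0)) (G.u e), ← h, smul_one]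

/-- The labels of the simplex of the twisted product that corresponds to a simplex of `M`. -/
def fib (y : M _⦋n⦌) (e : ⦋1⦌ ⟶ ⦋n⦌) : M _⦋1⦌ :=
  (G.τ (src e)).hom.app _ (Inner.bimul 1 (G.u e) (M.map e.op y))

theorem fib_restrict {m : ℕ} (θ : ⦋m⦌ ⟶ ⦋n⦌) (y : M _⦋n⦌) (e : ⦋1⦌ ⟶ ⦋m⦌) :
    (G.restrict θ).fib (M.map θ.op y) e = G.fib y (e ≫ θ) := by
  unfold fib
  rw [map_map]
  rfl

theorem act_eq (e : ⦋1⦌ ⟶ ⦋n⦌) (x : M _⦋1⦌) :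
    φ.act (H.map e.op b) ((G.τ (tgt e)).hom.app _ x) =
      (G.τ (src e)).hom.app _ ((G.u e).aut.hom.app _ x) := by
  have h : φ.t (H.map e.op b) * G.τ (tgt e) = G.τ (src e) * (G.u e).aut := by
    rw [G.aut_u, mul_assoc, mul_inv_cancel_left]
  exact congrArg (fun α : Aut M => α.hom.app (op ⦋1⦌) x) h

/-- The multiplication rule for labels. It is a product along four vertices in a gauge transform of
a 2-simplex of `M` with its last vertex doubled, where the gauges `u 01 ⋅ u 12` and `u 02` at the
doubled vertex differ by `η` (up to `τ`). -/
theorem hasProd_fib (y : M _⦋n⦌) (θ : ⦋2⦌ ⟶ ⦋n⦌) :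
    HasProd ![G.fib y (SimplexCategory.mkOfSucc 0 ≫ θ),
      φ.act (spine (H.map θ.op b) 0) (G.fib y (SimplexCategory.mkOfSucc 1 ≫ θ)),
      (φ.η (H.map θ.op b) : M _⦋1⦌)] (G.fib y (SimplexCategory.diag 2 ≫ θ)) := by
  have hy := (coherent_edgeBetween y).reindex (vert θ)
  have hg := (hy.reindex ![(0 : Fin 3), 1, 2, 2]).gauge
    ![1, G.u (SimplexCategory.mkOfSucc 0 ≫ θ),
      G.u (SimplexCategory.mkOfSucc 0 ≫ θ) * G.u (SimplexCategory.mkOfSucc 1 ≫ θ),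
      G.u (SimplexCategory.diag 2 ≫ θ)]
  have h := (hg.hasProd_three 0 1 2 3).app (G.τ (vert θ 0)).hom
  have h01 := extends_edgeBetween y (SimplexCategory.mkOfSucc 0 ≫ θ)
  have h12 := extends_edgeBetween y (SimplexCategory.mkOfSucc 1 ≫ θ)
  have h02 := extends_edgeBetween y (SimplexCategory.diag 2 ≫ θ)
  convert h using 1
  · funext i
    fin_cases i
    · change (G.τ (vert θ 0)).hom.app _ _ = (G.τ (vert θ 0)).hom.app _ _
      rw [h01]
      rfl
    · change φ.act (spine (H.map θ.op b) 0) ((G.τ (vert θ 1)).hom.app _ _) =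
        (G.τ (vert θ 0)).hom.app _ _
      rw [spine_map]
      refine (G.act_eq (SimplexCategory.mkOfSucc 0 ≫ θ) _).trans ?_
      refine congrArg (fun z => (G.τ (vert θ 0)).hom.app (op ⦋1⦌) z) ?_
      rw [← Inner.bimul_self, Inner.bimul_bimul, mul_one, h12]
      rfl
    · change (φ.inner (H.map θ.op b)).el = (G.τ (vert θ 0)).hom.app _ _
      rw [G.inner_eq, Inner.smul_el, ← Inner.bimul_unit]
      refine congrArg (fun z => (G.τ (vert θ 0)).hom.app (op ⦋1⦌) (Inner.bimul _ _ z)) ?_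
      exact ((coherent_edgeBetween y).self _).symm
  · change (G.τ (vert θ 0)).hom.app _ _ = (G.τ (vert θ 0)).hom.app _ _
    rw [h02]
    rfl

/-- The product `u_{01} u_{12} ⋯ u_{k-1,k}`, which compares the iterate of the actions of the
first `k` edges of the spine with the action of their product. -/
def pathProd (k : Fin (n + 1)) : Inner M :=
  (List.ofFn fun i : Fin k.val =>
    G.u (SimplexCategory.mkOfSucc (i.castLE (Nat.le_of_lt_succ k.isLt)))).prod

theorem pathProd_zero : G.pathProd 0 = 1 := rfl

theorem pathProd_succ (k : Fin n) :
    G.pathProd k.succ = G.pathProd k.castSucc * G.u (SimplexCategory.mkOfSucc k) := by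
  unfold pathProd
  rw [← List.prod_concat]
  refine congrArg List.prod ?_
  exact List.ofFn_succ' (n := k.val) _

theorem aut_pathProd (k : Fin (n + 1)) : (G.pathProd k).aut =
    (G.τ 0)⁻¹ * ((List.ofFn fun i : Fin k.val =>
      spine b (i.castLE (Nat.le_of_lt_succ k.isLt))).map φ.t).prod * G.τ k := by
  induction k using Fin.induction with
  | zero =>
    rw [pathProd_zero, Inner.one_aut]
    simp
  | succ k ih =>
    have h : (List.ofFn fun i : Fin k.succ.val =>
        spine b (i.castLE (Nat.le_of_lt_succ k.succ.isLt))) =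
        (List.ofFn fun i : Fin k.castSucc.val =>
          spine b (i.castLE (Nat.le_of_lt_succ k.castSucc.isLt))).concat (spine b k) :=
      List.ofFn_succ' (n := k.val) _
    rw [pathProd_succ, Inner.mul_aut, ih, h, G.aut_u, List.concat_eq_append, List.map_append,
      List.prod_append, List.map_singleton, List.prod_singleton]
    change _ * _ * G.τ k.castSucc * ((G.τ k.castSucc)⁻¹ * φ.t (spine b k) * G.τ k.succ) = _
    group

/-- In the trivialization, the word attached to the labels of a spine is a gauge transform of the
spine of the corresponding simplex of `M`. -/
theorem word_eq (y : Fin n → M _⦋1⦌) (k : Fin n) :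
    φ.word (spine b) (fun i => (G.τ i.castSucc).hom.app _
        (Inner.bimul 1 (G.u (SimplexCategory.mkOfSucc i)) (y i))) k =
      (G.τ 0).hom.app _ (Inner.bimul (G.pathProd k.castSucc) (G.pathProd k.succ) (y k)) := by
  have h := G.aut_pathProd k.castSucc
  rw [mul_assoc, ← inv_mul_eq_iff_eq_mul, inv_inv] at h
  unfold word
  rw [actList_eq]
  refine (congrArg (fun α : Aut M => α.hom.app (op ⦋1⦌) (Inner.bimul 1 _ (y k))) h).symm.trans ?_
  refine congrArg (fun z => (G.τ 0).hom.app (op ⦋1⦌) z) ?_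
  refine (Inner.bimul_self _ _).symm.trans ?_
  rw [Inner.bimul_bimul, mul_one, pathProd_succ]

theorem isSimplex_word (y : M _⦋n⦌) :
    IsSimplex (φ.word (spine b) fun i => G.fib y (SimplexCategory.mkOfSucc i)) := by
  have h := (((coherent_edgeBetween y).gauge G.pathProd).isSimplex id).app (G.τ 0).hom
  convert h using 1
  funext k
  refine (G.word_eq (spine y) k).trans ?_
  refine congrArg (fun z => (G.τ 0).hom.app (op ⦋1⦌) (Inner.bimul _ _ z)) ?_
  exact extends_edgeBetween y _

/-- A family of labels on the spine of the base whose word is a simplex of `M` comes from a simplex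
of `M` under the trivialization. -/
theorem exists_of_isSimplex_word (x : Fin n → M _⦋1⦌) (h : IsSimplex (φ.word (spine b) x)) :
    ∃ y : M _⦋n⦌, ∀ i, G.fib y (SimplexCategory.mkOfSucc i) = x i := by
  let y : Fin n → M _⦋1⦌ := fun i => Inner.bimul 1 (G.u (SimplexCategory.mkOfSucc i))⁻¹
    ((G.τ i.castSucc).inv.app _ (x i))
  have hy : ∀ i, (G.τ i.castSucc).hom.app _
      (Inner.bimul 1 (G.u (SimplexCategory.mkOfSucc i)) (y i)) = x i := fun i => by
    simp only [y, Inner.bimul_bimul, mul_one, mul_inv_cancel, Inner.bimul_one]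
    exact congrArg (fun f : M ⟶ M => f.app _ (x i)) (Iso.inv_hom_id (G.τ i.castSucc))
  obtain ⟨w, hw⟩ := h
  have hc := ((coherent_edgeBetween w).app (G.τ 0).inv).gauge fun i => (G.pathProd i)⁻¹
  have hspine : ∀ i, spine (hc.simplex id) i = y i := fun i => by
    rw [hc.spine_simplex]
    have h1 : edgeBetween w i.castSucc i.succ = _ :=
      ((extends_edgeBetween w _).symm.trans (congrFun hw i)).trans
        ((congrArg (fun x => φ.word (spine b) x i) (funext hy)).symm.trans (G.word_eq y i))
    simp only [id]
    rw [h1]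
    have h2 : ∀ z, (G.τ 0).inv.app (op ⦋1⦌) ((G.τ 0).hom.app (op ⦋1⦌) z) = z := fun z =>
      congrArg (fun f : M ⟶ M => f.app _ z) (Iso.hom_inv_id (G.τ 0))
    rw [h2, Inner.bimul_bimul, inv_mul_cancel, inv_mul_cancel, Inner.bimul_one]
  refine ⟨hc.simplex id, fun i => ?_⟩
  rw [← hy i, ← hspine i]
  rfl

/-- The simplex of the twisted product over `b` that corresponds to a simplex of `M`. -/
def toSimplex (y : M _⦋n⦌) : φ.Simplex ⦋n⦌ where
  base := b
  fib := G.fib y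
  fib_const i := by
    have h : src (SimplexCategory.σ 0 ≫ i) = tgt (SimplexCategory.σ 0 ≫ i) := rfl
    rw [fib, G.u_eq_one h, Inner.bimul_one, map_const_eq_unit _ h, app_unit]
  fib_mul θ := G.hasProd_fib y θ
  fib_word m θ := by
    have := (G.restrict θ).isSimplex_word (M.map θ.op y)
    simp only [fib_restrict] at this
    exact this

theorem fib_injective {y y' : M _⦋n⦌} (h : ∀ e, G.fib y e = G.fib y' e) : y = y' := by
  refine edge_ext fun e => ?_
  have h1 := congrArg (fun z => Inner.bimul 1 (G.u e)⁻¹ ((G.τ (src e)).inv.app (op ⦋1⦌) z)) (h e)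
  have h2 : ∀ z, (G.τ (src e)).inv.app (op ⦋1⦌) ((G.τ (src e)).hom.app (op ⦋1⦌) z) = z := fun z =>
    congrArg (fun f : M ⟶ M => f.app _ z) (Iso.hom_inv_id (G.τ (src e)))
  simpa only [fib, h2, Inner.bimul_bimul, mul_one, inv_mul_cancel, Inner.bimul_one] using h1

theorem exists_toSimplex_eq (s : φ.Simplex ⦋n⦌) (hs : s.base = b) :
    ∃ y : M _⦋n⦌, G.toSimplex y = s := by
  have h := s.fib_word n (𝟙 _)
  simp only [Category.comp_id, op_id, Functor.map_id_apply, hs] at h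
  obtain ⟨y, hy⟩ := G.exists_of_isSimplex_word _ h
  exact ⟨y, Simplex.ext_spine hs.symm hy⟩

end Gauge

end TwistingPair

/-! ### Twisted products are fibre bundles -/

/-- Pullbacks of simplicial sets are computed levelwise. -/
theorem isPullback_iff {P X Y Z : SSet.{u}} {p : P ⟶ X} {q : P ⟶ Y} {f : X ⟶ Z} {g : Y ⟶ Z} :
    IsPullback p q f g ↔ p ≫ f = q ≫ g ∧
      (∀ (n : ℕ) (a b : P _⦋n⦌), p.app _ a = p.app _ b → q.app _ a = q.app _ b → a = b) ∧
      ∀ (n : ℕ) (x : X _⦋n⦌) (y : Y _⦋n⦌), f.app _ x = g.app _ y →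
        ∃ a : P _⦋n⦌, p.app _ a = x ∧ q.app _ a = y := by
  constructor
  · intro h
    have key := fun n : ℕ => (Limits.Types.isPullback_iff _ _ _ _).1
      (h.map ((evaluation SimplexCategoryᵒᵖ (Type u)).obj (op ⦋n⦌)))
    exact ⟨h.w, fun n a b h1 h2 => (key n).2.1 a b ⟨h1, h2⟩, fun n => (key n).2.2⟩
  · rintro ⟨h0, h1, h2⟩
    refine ⟨⟨h0⟩, ⟨Limits.evaluationJointlyReflectsLimits _ (fun ⟨⟨n⟩⟩ => ?_)⟩⟩
    refine (Limits.isLimitMapConePullbackConeEquiv _ _).2 (IsPullback.isLimit ?_)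
    refine Limits.Types.isPullback_iff _ _ _ _ |>.2 ⟨NatTrans.congr_app h0 _,
      fun a b h => h1 n a b h.1 h.2, h2 n⟩

/-- The Yoneda lemma for maps out of a standard simplex. -/
theorem app_eq_map {X : SSet.{u}} {n m : ℕ} (b : Δ[n] ⟶ X) (s : (Δ[n] : SSet.{u}) _⦋m⦌) :
    b.app _ s = X.map (SSet.stdSimplex.objEquiv s).op
      (b.app _ (SSet.stdSimplex.objEquiv.symm (𝟙 ⦋n⦌))) := by
  refine Eq.trans ?_ (map_app b (SSet.stdSimplex.objEquiv s)
    (SSet.stdSimplex.objEquiv.symm (𝟙 ⦋n⦌)))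
  refine congrArg (fun z => b.app (op ⦋m⦌) z) ?_
  ext i
  rfl

/-- A three-fold product can be bracketed. -/
theorem HasProd.exists_right {M : SSet.{u}} [PartialGroup M] {a b c z : M _⦋1⦌}
    (h : HasProd ![a, b, c] z) : ∃ d, HasProd ![b, c] d ∧ HasProd ![a, d] z := by
  obtain ⟨w, hw, rfl⟩ := h
  have hc := coherent_edgeBetween w
  have h0 : edgeBetween w 0 1 = a := (extends_edgeBetween w _).symm.trans (congrFun hw 0)
  have h1 : edgeBetween w 1 2 = b := (extends_edgeBetween w _).symm.trans (congrFun hw 1)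
  have h2 : edgeBetween w 2 3 = c := (extends_edgeBetween w _).symm.trans (congrFun hw 2)
  have h3 : edgeBetween w 0 3 = prodEdge w :=
    (extends_edgeBetween w (SimplexCategory.diag 3)).symm
  refine ⟨edgeBetween w 1 3, ?_, ?_⟩
  · rw [← h1, ← h2]
    exact hc.hasProd_two 1 2 3
  · rw [← h0, ← h3]
    exact hc.hasProd_two 0 1 3

namespace TwistingPair

variable {H M : SSet.{u}} [PartialGroup H] [PartialGroup M] (φ : TwistingPair H M)

/-- The trivialization over the simplex with vertices `θ` of a coherent family of `H`, given by the
section over the edges issuing from the vertex `o`. The vertices `θ` need not be increasing, and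
`o` need not be one of them. -/
def starGauge {V : Type} {h : V → V → H _⦋1⦌} (hh : Coherent h) (o : V) {n : ℕ}
    (θ : Fin (n + 1) → V) : φ.Gauge (hh.simplex θ) where
  τ i := (φ.t (h o (θ i)))⁻¹
  u e := φ.inner (hh.simplex ![o, θ (src e), θ (tgt e)])
  aut_u e := by
    change φ.t (spine _ 0) * φ.t (spine _ 1) * (φ.t (prodEdge _))⁻¹ = _
    rw [hh.spine_simplex, hh.spine_simplex, hh.prodEdge_simplex, hh.map_simplex_edge, inv_inv]
    rfl
  inner_eq f := by
    have hc := φ.inner_cocycle (hh.simplex ![o, θ (vert f 0), θ (vert f 1), θ (vert f 2)])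
    have hv : ∀ {a b c : V} {g : ⦋2⦌ ⟶ ⦋3⦌},
        (fun i => (![o, θ (vert f 0), θ (vert f 1), θ (vert f 2)] : Fin 4 → V) (vert g i)) =
          ![a, b, c] →
        H.map g.op (hh.simplex ![o, θ (vert f 0), θ (vert f 1), θ (vert f 2)]) =
          hh.simplex ![a, b, c] := fun hg => by rw [hh.map_simplex, hg]
    unfold SimplicialObject.δ at hc
    rw [hv (a := θ (vert f 0)) (b := θ (vert f 1)) (c := θ (vert f 2))
        (by funext i; fin_cases i <;> rfl),
      hv (g := SimplexCategory.δ 2) (a := o) (b := θ (vert f 0)) (c := θ (vert f 2))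
        (by funext i; fin_cases i <;> rfl),
      hv (g := SimplexCategory.δ 3) (a := o) (b := θ (vert f 0)) (c := θ (vert f 1))
        (by funext i; fin_cases i <;> rfl),
      hv (g := SimplexCategory.δ 1) (a := o) (b := θ (vert f 1)) (c := θ (vert f 2))
        (by funext i; fin_cases i <;> rfl),
      hh.spine_simplex] at hc
    rw [← eq_mul_inv_iff_mul_eq] at hc
    rw [eq_inv_smul_iff]
    refine Eq.trans ?_ hc
    rw [hh.map_simplex]
    refine congrArg (fun s => φ.t (h o (θ (vert f 0))) • φ.inner (hh.simplex s)) ?_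
    funext i
    fin_cases i <;> rfl

theorem starGauge_restrict {V : Type} {h : V → V → H _⦋1⦌} (hh : Coherent h) (o : V) {m n : ℕ}
    (θ : Fin (n + 1) → V) (f : ⦋m⦌ ⟶ ⦋n⦌) (y : M _⦋n⦌) :
    ((φ.starGauge hh o θ).toSimplex y).restrict f =
      (φ.starGauge hh o fun i => θ (vert f i)).toSimplex (M.map f.op y) := by
  refine Simplex.ext (hh.map_simplex θ f) (funext fun e => ?_)
  exact congrArg (fun z => ((φ.t (h o (θ (vert f (src e)))))⁻¹).hom.app (op ⦋1⦌) (Inner.bimul 1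
    (φ.inner (hh.simplex ![o, θ (vert f (src e)), θ (vert f (tgt e))])) z)) (map_map e f y).symm

/-- The trivialization of the twisted product over a simplex `b`. -/
def trivialization {n : ℕ} (b : H _⦋n⦌) : M ⊗ Δ[n] ⟶ φ.product where
  app m := ↾fun p => (φ.starGauge (coherent_edgeBetween b) 0
    (vert (m := m.unop.len) (SSet.stdSimplex.objEquiv p.2))).toSimplex p.1
  naturality m m' f := by
    ext ⟨y, s⟩
    exact (φ.starGauge_restrict (coherent_edgeBetween b) 0
      (vert (m := m.unop.len) (SSet.stdSimplex.objEquiv s)) (m := m'.unop.len) f.unop y).symm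

theorem isPullback_trivialization {n : ℕ} (b : Δ[n] ⟶ H) :
    IsPullback (φ.trivialization (b.app _ (SSet.stdSimplex.objEquiv.symm (𝟙 ⦋n⦌))))
      (snd M Δ[n]) φ.proj b := by
  set c := b.app _ (SSet.stdSimplex.objEquiv.symm (𝟙 ⦋n⦌)) with hc
  have hb : ∀ (m : ℕ) (s : (Δ[n] : SSet.{u}) _⦋m⦌),
      b.app _ s = (coherent_edgeBetween c).simplex (vert (SSet.stdSimplex.objEquiv s)) := by
    intro m s
    rw [(extends_edgeBetween c).simplex_eq (coherent_edgeBetween c), hc]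
    exact app_eq_map b s
  refine isPullback_iff.2 ⟨sset_hom_ext fun m p => (hb m p.2).symm, ?_, ?_⟩
  · rintro m ⟨y, s⟩ ⟨y', s'⟩ h hs
    obtain rfl : s = s' := hs
    have hy : y = y' := Gauge.fib_injective _ fun e => congrFun (congrArg Simplex.fib h) e
    rw [hy]
  · intro m x s hx
    obtain ⟨y, hy⟩ := (φ.starGauge (coherent_edgeBetween c) 0
      (vert (SSet.stdSimplex.objEquiv s))).exists_toSimplex_eq x (hx.trans (hb m s))
    exact ⟨(y, s), hy, rfl⟩

theorem exists_gauge {n : ℕ} (b : H _⦋n⦌) : Nonempty (φ.Gauge b) := by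
  have := φ.starGauge (coherent_edgeBetween b) 0 id
  rw [show (coherent_edgeBetween b).simplex id = b from
    ((extends_edgeBetween b).simplex_eq _ (𝟙 _)).trans
      (by rw [op_id, Functor.map_id_apply])] at this
  exact ⟨this⟩

theorem isFibreBundle_proj : IsFibreBundle M φ.proj where
  surjective n b := by
    obtain ⟨G⟩ := φ.exists_gauge b
    let y : M _⦋n⦌ := M.map ((⦋n⦌ : SimplexCategory).const ⦋0⦌ 0).op
      (IsPartialMonoid.reduced (M := M)).choose
    exact ⟨G.toSimplex y, rfl⟩
  locallyTrivial n b := ⟨_, φ.isPullback_trivialization b⟩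

theorem exists_spine_iff {n : ℕ} (x : Fin n → M _⦋1⦌) (g : Fin n → H _⦋1⦌) :
    (∃ s : φ.product _⦋n⦌, ∀ i, φ.label (spine s i) = (x i, g i)) ↔
      (IsSimplex g ∧ IsSimplex (φ.word g x)) := by
  constructor
  · rintro ⟨s, hs⟩
    have hg : spine (Simplex.base s) = g := funext fun i => congrArg Prod.snd (hs i)
    have hx : (fun i => Simplex.fib s (SimplexCategory.mkOfSucc i)) = x :=
      funext fun i => congrArg Prod.fst (hs i)
    refine ⟨⟨_, hg⟩, ?_⟩
    have h := Simplex.fib_word s n (𝟙 _)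
    simp only [Category.comp_id, op_id, Functor.map_id_apply] at h
    rw [hg, hx] at h
    exact h
  · rintro ⟨⟨b, rfl⟩, hw⟩
    obtain ⟨G⟩ := φ.exists_gauge b
    obtain ⟨y, hy⟩ := G.exists_of_isSimplex_word x hw
    exact ⟨G.toSimplex y, fun i => Prod.ext (hy i) rfl⟩

theorem word_of_unit {n : ℕ} {g : Fin n → H _⦋1⦌} (hg : ∀ i, g i = unit H)
    (x : Fin n → M _⦋1⦌) : φ.word g x = x := by
  funext k
  refine φ.actList_unit _ ?_ _
  intro a ha
  obtain ⟨i, rfl⟩ := List.mem_ofFn.1 ha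
  exact hg _

theorem label_incl (x : M _⦋1⦌) : φ.label (φ.incl.app _ x) = (x, unit H) := by
  refine Prod.ext ?_ ?_
  · change M.map (𝟙 ⦋1⦌ : ⦋1⦌ ⟶ ⦋1⦌).op x = x
    rw [op_id, Functor.map_id_apply]
  · exact congrArg (fun f : ⦋1⦌ ⟶ ⦋0⦌ => H.map f.op (IsPartialMonoid.reduced (M := H)).choose)
      (Subsingleton.elim _ _)

theorem isFibreInclusion_incl : IsFibreInclusion φ.incl φ.proj := by
  intro v
  have hv : ∀ (n : ℕ) (s : (Δ[0] : SSet.{u}) _⦋n⦌) (b : H _⦋0⦌) (f : ⦋n⦌ ⟶ ⦋0⦌),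
      v.app _ s = H.map f.op b := by
    intro n s b f
    rw [app_eq_map v s, vertex_eq b]
    exact congrArg (fun f : ⦋n⦌ ⟶ ⦋0⦌ => H.map f.op _) (Subsingleton.elim _ _)
  refine ⟨SSet.const (SSet.stdSimplex.obj₀Equiv.symm 0), isPullback_iff.2 ⟨?_, ?_, ?_⟩⟩
  · exact sset_hom_ext fun n x => (hv n _ _ _).symm
  · intro n a b h _
    refine edge_ext fun e => ?_
    exact congrFun (congrArg Simplex.fib h) e
  · intro n s p hs
    have hs' : Simplex.base s = _ := hs.trans
      (hv n p (IsPartialMonoid.reduced (M := H)).choose ((⦋n⦌ : SimplexCategory).const ⦋0⦌ 0))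
    have h := Simplex.fib_word s n (𝟙 _)
    simp only [Category.comp_id, op_id, Functor.map_id_apply] at h
    rw [φ.word_of_unit fun i => by
      rw [hs', spine_map]
      exact map_const_eq_unit _ (Subsingleton.elim (α := Fin 1) _ _)] at h
    obtain ⟨y, hy⟩ := h
    refine ⟨y, Simplex.ext_spine hs'.symm fun i => congrFun hy i, ?_⟩
    exact SSet.stdSimplex.ext _ _ fun i => Subsingleton.elim (α := Fin 1) _ _

theorem label_bijective : Function.Bijective φ.label := by
  constructor
  · intro s s' h
    refine Simplex.ext_spine (congrArg Prod.snd h) fun i => ?_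
    have hi : SimplexCategory.mkOfSucc i = 𝟙 ⦋1⦌ := by
      obtain rfl : i = 0 := Subsingleton.elim _ _
      exact SimplexCategory.mkOfSucc_eq_id
    have h1 := congrArg Prod.fst h
    rw [hi]
    exact h1
  · rintro ⟨x, g⟩
    obtain ⟨G⟩ := φ.exists_gauge g
    obtain ⟨y, hy⟩ := G.exists_of_isSimplex_word (fun _ => x)
      ⟨x, by
        funext i
        obtain rfl : i = 0 := Subsingleton.elim _ _
        exact map_edge_one rfl rfl⟩
    refine ⟨G.toSimplex y, Prod.ext ((congrArg (G.fib y) ?_).trans (hy 0)) rfl⟩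
    exact SimplexCategory.mkOfSucc_eq_id.symm

theorem isPartialMonoid_product : IsPartialMonoid φ.product where
  reduced := by
    refine ⟨φ.incl.app _ (IsPartialMonoid.reduced (M := M)).choose, fun w => ?_⟩
    exact Simplex.ext_spine (vertex_eq _ _) fun i => i.elim0
  spine_injective n hn s s' h :=
    Simplex.ext_spine (spine_ext hn fun i => congrArg (fun a => (φ.label a).2) (congrFun h i))
      fun i => congrArg (fun a => (φ.label a).1) (congrFun h i)

end TwistingPair

/-! ### Twisted products are partial groups -/

section Criterion

variable {X : SSet.{u}} [IsPartialMonoid X]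

/-- A partial monoid is a partial group as soon as each simplex extends to a coherent family and
left inverses are unique: the inverse of a simplex is then obtained by reading a coherent family
backwards. -/
theorem nonempty_partialGroup_of_coherent
    (hX : ∀ (n : ℕ) (w : X _⦋n⦌), ∃ x : Fin (n + 1) → Fin (n + 1) → X _⦋1⦌,
      Coherent x ∧ Extends x w)
    (hu : ∀ a a' b : X _⦋1⦌, HasProd ![a, b] (unit X) → HasProd ![a', b] (unit X) → a = a') :
    Nonempty (PartialGroup X) := by
  choose x hx hxw using hX
  let ν : X _⦋1⦌ → X _⦋1⦌ := fun a => x 1 a 1 0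
  have hν : ∀ {V : Type} {y : V → V → X _⦋1⦌}, Coherent y → ∀ i j, ν (y i j) = y j i := by
    intro V y hy i j
    refine hu _ _ (y i j) ?_ ?_
    · have h := (hx 1 (y i j)).hasProd_two 1 0 1
      rw [(hx 1 (y i j)).self] at h
      have h1 : y i j = x 1 (y i j) 0 1 :=
        (map_edge_one (e := 𝟙 _) rfl rfl).symm.trans (hxw 1 (y i j) (𝟙 _))
      rwa [← h1] at h
    · have h := hy.hasProd_two j i j
      rwa [hy.self] at h
  let inv : ∀ n, X _⦋n⦌ → X _⦋n⦌ := fun n w => (hx n w).simplex Fin.rev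
  have hinv : ∀ (n : ℕ) (w : X _⦋n⦌) (e : ⦋1⦌ ⟶ ⦋n⦌), X.map e.op (inv n w) =
      ν (X.map (SimplexCategory.rev.map e : ⦋1⦌ ⟶ ⦋n⦌).op w) := by
    intro n w e
    rw [(hx n w).map_simplex_edge, hxw n w, hν (hx n w)]
    rfl
  have hνν : ∀ a, ν (ν a) = a := by
    intro a
    have h1 : x 1 a 0 1 = a := ((hxw 1 a (𝟙 _)).symm.trans (map_edge_one rfl rfl))
    exact (hν (hx 1 a) 1 0).trans h1
  refine ⟨{
    inversion :=
      { app := fun n => ↾fun w => SSet.opObjEquiv.symm (inv n.unop.len w)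
        naturality := ?_ }
    inversion_inversion := ?_
    inversion_mul := ?_ }⟩
  · intro n m f
    induction n using Opposite.rec with | _ n => ?_
    induction n using SimplexCategory.rec with | _ n => ?_
    induction m using Opposite.rec with | _ m => ?_
    induction m using SimplexCategory.rec with | _ m => ?_
    ext w
    change inv m (X.map f w) = X.map (SimplexCategory.rev.map f.unop : ⦋m⦌ ⟶ ⦋n⦌).op (inv n w)
    refine edge_ext fun e => ?_
    rw [map_map, hinv, hinv]
    refine congrArg ν ((map_map _ f.unop w).trans ?_)
    refine congrArg (fun e : ⦋1⦌ ⟶ ⦋n⦌ => X.map e.op w) ?_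
    refine edge_hom_ext ?_ ?_
    · rw [src_rev, src_comp, src_rev, tgt_comp]
      change _ = (f.unop.toOrderHom (tgt e).rev).rev.rev
      rw [Fin.rev_rev]
      rfl
    · rw [tgt_rev, tgt_comp, tgt_rev, src_comp]
      change _ = (f.unop.toOrderHom (src e).rev).rev.rev
      rw [Fin.rev_rev]
      rfl
  · intro n w
    change inv n (inv n w) = w
    refine edge_ext fun e => ?_
    rw [hinv, hinv, hνν]
    refine congrArg (fun e : ⦋1⦌ ⟶ ⦋n⦌ => X.map e.op w) (edge_hom_ext ?_ ?_)
    · exact Fin.rev_rev _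
    · exact Fin.rev_rev _
  · intro n hn w
    change HasProd (Fin.append (spine (inv n w)) (spine w)) (unit X)
    let θ : Fin (n + n + 1) → Fin (n + 1) := fun k =>
      if k.val ≤ n then ⟨n - k.val, by omega⟩ else ⟨k.val - n, by omega⟩
    have hθ : ∀ (k : Fin (n + n + 1)) (i : Fin (n + 1)),
        (k.val + i.val = n ∨ k.val = n + i.val) → θ k = i := by
      intro k i h
      simp only [θ]
      split_ifs with hk
      · exact Fin.ext (by change n - k.val = _; omega)
      · exact Fin.ext (by change k.val - n = _; omega)
    refine ⟨(hx n w).simplex θ, ?_, ?_⟩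
    · funext k
      rw [(hx n w).spine_simplex]
      refine Fin.addCases (fun i => ?_) (fun i => ?_) k
      · rw [Fin.append_left]
        change _ = spine ((hx n w).simplex Fin.rev) i
        rw [(hx n w).spine_simplex, hθ _ i.castSucc.rev (Or.inl ?_), hθ _ i.succ.rev (Or.inl ?_)]
        · rw [Fin.val_rev]
          simp only [Fin.val_succ, Fin.val_castAdd]
          omega
        · rw [Fin.val_rev]
          simp only [Fin.val_castSucc, Fin.val_castAdd]
          omega
      · rw [Fin.append_right, hθ _ i.castSucc (Or.inr ?_), hθ _ i.succ (Or.inr ?_)]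
        · exact (hxw n w (SimplexCategory.mkOfSucc i)).symm
        · simp only [Fin.val_succ, Fin.val_natAdd]
          omega
        · simp only [Fin.val_castSucc, Fin.val_natAdd]
    · rw [(hx n w).prodEdge_simplex, hθ 0 (Fin.last n) (Or.inl (by simp)),
        hθ (Fin.last (n + n)) (Fin.last n) (Or.inr (by simp)), (hx n w).self]

end Criterion

/-- The structure of a partial group can be transported along an isomorphism. -/
theorem nonempty_partialGroup_of_iso {X Y : SSet.{u}} [PartialGroup X] (f : X ≅ Y) :
    Nonempty (PartialGroup Y) := by
  have hf : ∀ (n : ℕ) (y : Y _⦋n⦌), f.hom.app _ (f.inv.app _ y) = y := fun n y =>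
    congrArg (fun g : Y ⟶ Y => g.app (op ⦋n⦌) y) f.inv_hom_id
  have hf' : ∀ (n : ℕ) (x : X _⦋n⦌), f.inv.app _ (f.hom.app _ x) = x := fun n x =>
    congrArg (fun g : X ⟶ X => g.app (op ⦋n⦌) x) f.hom_inv_id
  have : IsPartialMonoid Y :=
    { reduced := by
        refine ⟨f.hom.app _ (IsPartialMonoid.reduced (M := X)).choose, fun w => ?_⟩
        rw [← hf 0 w, vertex_eq (f.inv.app _ w)]
      spine_injective := fun n hn w w' h => by
        rw [← hf n w, ← hf n w']
        refine congrArg _ (spine_ext hn fun i => ?_)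
        rw [spine_app, spine_app, congrFun h i] }
  refine nonempty_partialGroup_of_coherent (fun n w => ?_) fun a a' b h h' => ?_
  · refine ⟨_, (coherent_edgeBetween (f.inv.app _ w)).app f.hom, fun e => ?_⟩
    rw [← extends_edgeBetween, ← map_app, hf]
  · have key : ∀ a, HasProd ![a, b] (unit Y) →
        HasProd ![f.inv.app _ a, f.inv.app _ b] (unit X) := fun a h => by
      convert h.app f.inv using 1
      · funext i
        fin_cases i <;> rfl
      · exact (app_unit f.inv).symm
    rw [← hf 1 a, ← hf 1 a', (key a h).right_cancel (key a' h')]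

namespace TwistingPair

variable {H M : SSet.{u}} [PartialGroup H] [PartialGroup M] (φ : TwistingPair H M)

/-- The product formula `(x, g)(z, h) = (x ⋅ t(g)(z) ⋅ η(g, h), gh)` in the fibre coordinate. -/
theorem label_hasProd (s : φ.product _⦋2⦌) :
    HasProd ![(φ.label (spine s 0)).1, φ.act (φ.label (spine s 0)).2 (φ.label (spine s 1)).1,
      (φ.η (Simplex.base s) : M _⦋1⦌)] (φ.label (prodEdge s)).1 := by
  have h := Simplex.fib_mul s (𝟙 _)
  rw [op_id, Functor.map_id_apply] at h
  exact h

/-- Every simplex of the twisted product extends to a coherent family: extend its base and its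
coordinate in a trivialization, and trivialize by a star that is defined over all sequences of
vertices of the base. -/
theorem coherent_extends (n : ℕ) (s : φ.product _⦋n⦌) :
    ∃ x : Fin (n + 1) → Fin (n + 1) → φ.product _⦋1⦌, Coherent x ∧ Extends x s := by
  have hb := coherent_edgeBetween (Simplex.base s)
  have hs : hb.simplex id = Simplex.base s :=
    ((extends_edgeBetween _).simplex_eq _ (𝟙 _)).trans (by rw [op_id, Functor.map_id_apply])
  obtain ⟨y, hy⟩ := (φ.starGauge hb 0 id).exists_toSimplex_eq s hs.symm
  have hyc := coherent_edgeBetween y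
  have key : ∀ (m : ℕ) (θ : Fin (m + 1) → Fin (n + 1)) (e : ⦋1⦌ ⟶ ⦋m⦌),
      ((φ.starGauge hb 0 θ).toSimplex (hyc.simplex θ)).restrict e =
        (φ.starGauge hb 0 ![θ (src e), θ (tgt e)]).toSimplex
          (hyc.simplex ![θ (src e), θ (tgt e)]) := by
    intro m θ e
    rw [φ.starGauge_restrict, hyc.map_simplex]
    have h : (fun i => θ (vert e i)) = ![θ (src e), θ (tgt e)] := by
      funext i
      fin_cases i <;> rfl
    rw [h]
  refine ⟨fun i j => (φ.starGauge hb 0 ![i, j]).toSimplex (hyc.simplex ![i, j]),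
    fun m θ => ⟨(φ.starGauge hb 0 θ).toSimplex (hyc.simplex θ), key m θ⟩, fun e => ?_⟩
  have hyid : hyc.simplex id = y :=
    ((extends_edgeBetween _).simplex_eq _ (𝟙 _)).trans (by rw [op_id, Functor.map_id_apply])
  have h := key n id e
  rw [hyid, hy] at h
  exact h

theorem label_unit [IsPartialMonoid φ.product] :
    φ.label (unit φ.product) = (unit M, unit H) := by
  rw [← app_unit φ.incl, φ.label_incl]

theorem base_hasProd (s : φ.product _⦋2⦌) :
    HasProd ![(φ.label (spine s 0)).2, (φ.label (spine s 1)).2] (φ.label (prodEdge s)).2 := by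
  refine ⟨Simplex.base s, ?_, rfl⟩
  funext i
  fin_cases i <;> rfl

/-- If `(x, g)` is a left inverse of `(z, h)`, then `g = h⁻¹` and `x` is the inverse of
`t(g)(z) ⋅ η(g, h)`. -/
theorem label_of_hasProd_unit [IsPartialMonoid φ.product] {a b : φ.product _⦋1⦌}
    (h : HasProd ![a, b] (unit φ.product)) {k : H _⦋2⦌}
    (hk : spine k = ![inverse (φ.label b).2, (φ.label b).2]) :
    (φ.label a).2 = inverse (φ.label b).2 ∧
      HasProd ![inverse (φ.η k : M _⦋1⦌),
        φ.act (inverse (φ.label b).2) (inverse (φ.label b).1)] (φ.label a).1 := by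
  obtain ⟨s, hs, hs'⟩ := h
  have h0 : spine s 0 = a := congrFun hs 0
  have h1 : spine s 1 = b := congrFun hs 1
  have hb := φ.base_hasProd s
  rw [h0, h1, hs', label_unit] at hb
  have ha : (φ.label a).2 = inverse (φ.label b).2 := hb.right_cancel (hasProd_inverse_left _)
  have hbase : Simplex.base s = k := by
    refine spine_ext (by omega) fun i => ?_
    rw [hk, ← ha, ← h0, ← h1]
    fin_cases i <;> rfl
  have hf := φ.label_hasProd s
  rw [h0, h1, hs', label_unit, ha, hbase] at hf
  obtain ⟨d, hd, hd'⟩ := hf.exists_right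
  refine ⟨ha, ?_⟩
  have h2 : (φ.label a).1 = inverse d := hd'.right_cancel (hasProd_inverse_left d)
  rw [h2, act, inverse_app]
  exact hd.inverse

theorem nonempty_partialGroup : Nonempty (PartialGroup φ.product) := by
  have := φ.isPartialMonoid_product
  refine nonempty_partialGroup_of_coherent φ.coherent_extends fun a a' b h h' => ?_
  obtain ⟨k, hk, -⟩ := hasProd_inverse_left (φ.label b).2
  have h1 := φ.label_of_hasProd_unit h hk
  have h2 := φ.label_of_hasProd_unit h' hk
  exact φ.label_bijective.1 (Prod.ext (h1.2.unique (by omega) h2.2) (h1.1.trans h2.1.symm))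

end TwistingPair

/-! ### Trivializations of a fibre bundle -/

/-- The inclusion of `M` in `M × Δ[n]` over a vertex. -/
def vertexIncl (M : SSet.{u}) {n : ℕ} (i : Fin (n + 1)) : M ⟶ M ⊗ Δ[n] :=
  lift (𝟙 M) (SSet.const (SSet.stdSimplex.obj₀Equiv.symm i))

theorem app_const {Z H : SSet.{u}} [IsPartialMonoid H] {n : ℕ} (β : Δ[n] ⟶ H) (i : Fin (n + 1))
    (k : ℕ) (z : Z _⦋k⦌) (v : H _⦋0⦌) (f : ⦋k⦌ ⟶ ⦋0⦌) :
    (SSet.const (X := Z) (SSet.stdSimplex.obj₀Equiv.symm i) ≫ β).app _ z = H.map f.op v := by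
  rw [SSet.const_comp, vertex_eq v]
  exact congrArg (fun f : ⦋k⦌ ⟶ ⦋0⦌ => H.map f.op _) (Subsingleton.elim _ _)

section FibreBundle

variable {M H E : SSet.{u}} [PartialGroup H] {ρ : E ⟶ H} {ι : M ⟶ E}

/-- A trivialization over a simplex restricts to an identification of `M` with the fibre. -/
theorem isPullback_vertexIncl {n : ℕ} {a : M ⊗ Δ[n] ⟶ E} {β : Δ[n] ⟶ H}
    (h : IsPullback a (snd M Δ[n]) ρ β) (i : Fin (n + 1)) (v : Δ[0] ⟶ H) :
    IsPullback (vertexIncl M i ≫ a) (SSet.const (SSet.stdSimplex.obj₀Equiv.symm 0)) ρ v := by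
  obtain ⟨h0, h1, h2⟩ := isPullback_iff.1 h
  have hβ : ∀ (k : ℕ) (m : M _⦋k⦌), (vertexIncl M i ≫ snd M Δ[n] ≫ β).app _ m =
      H.map ((⦋k⦌ : SimplexCategory).const ⦋0⦌ 0).op (IsPartialMonoid.reduced (M := H)).choose :=
    fun k m => app_const β i k m _ _
  refine isPullback_iff.2 ⟨?_, fun k m m' hm _ => ?_, fun k x s hx => ?_⟩
  · rw [Category.assoc, h0]
    exact sset_hom_ext fun k m => (hβ k m).trans (app_const v 0 k m _ _).symm
  · exact congrArg Prod.fst (h1 k (m, _) (m', _) hm rfl)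
  · have hs : v.app _ s = H.map ((⦋k⦌ : SimplexCategory).const ⦋0⦌ 0).op
        (IsPartialMonoid.reduced (M := H)).choose := by
      rw [app_eq_map v s, vertex_eq (v.app _ _)]
      exact congrArg (fun f : ⦋k⦌ ⟶ ⦋0⦌ => H.map f.op _) (Subsingleton.elim _ _)
    obtain ⟨⟨m, s'⟩, hm, hs'⟩ := h2 k x ((SSet.const (X := Δ[0])
      (SSet.stdSimplex.obj₀Equiv.symm i)).app _ s) (hx.trans (hs.trans
        (app_const β i k s _ ((⦋k⦌ : SimplexCategory).const ⦋0⦌ 0)).symm))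
    obtain rfl : s' = _ := hs'
    exact ⟨m, hm, SSet.stdSimplex.ext _ _ fun i => Subsingleton.elim (α := Fin 1) _ _⟩

theorem exists_isFibreInclusion (hρ : IsFibreBundle M ρ) : ∃ ι : M ⟶ E, IsFibreInclusion ι ρ := by
  obtain ⟨a, ha⟩ := hρ.locallyTrivial 0
    (SSet.yonedaEquiv.symm (IsPartialMonoid.reduced (M := H)).choose)
  exact ⟨vertexIncl M 0 ≫ a, fun v => ⟨_, isPullback_vertexIncl ha 0 v⟩⟩

theorem exists_aut_vertexIncl (hι : IsFibreInclusion ι ρ) {n : ℕ} {a : M ⊗ Δ[n] ⟶ E}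
    {β : Δ[n] ⟶ H} (h : IsPullback a (snd M Δ[n]) ρ β) (i : Fin (n + 1)) :
    ∃ τ : Aut M, τ.hom ≫ ι = vertexIncl M i ≫ a := by
  let v : Δ[0] ⟶ H := SSet.yonedaEquiv.symm (IsPartialMonoid.reduced (M := H)).choose
  obtain ⟨p, hp⟩ := hι v
  exact ⟨(isPullback_vertexIncl h i v).isoIsPullback _ _ hp,
    IsPullback.isoIsPullback_hom_fst _ _ _ _⟩

theorem fibreInclusion_injective (hι : IsFibreInclusion ι ρ) {n : ℕ} {x y : M _⦋n⦌}
    (h : ι.app _ x = ι.app _ y) : x = y := by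
  obtain ⟨p, hp⟩ := hι (SSet.yonedaEquiv.symm (IsPartialMonoid.reduced (M := H)).choose)
  exact (isPullback_iff.1 hp).2.1 n x y h
    (SSet.stdSimplex.ext _ _ fun i => Subsingleton.elim (α := Fin 1) _ _)

theorem fibreInclusion_hom_ext (hι : IsFibreInclusion ι ρ) {Z : SSet.{u}} {f g : Z ⟶ M}
    (h : f ≫ ι = g ≫ ι) : f = g :=
  sset_hom_ext fun n z => fibreInclusion_injective hι
    (congrArg (fun k : Z ⟶ E => k.app (op ⦋n⦌) z) h)

theorem map_unit_eq {n : ℕ} (f : ⦋n⦌ ⟶ ⦋1⦌) (g : ⦋n⦌ ⟶ ⦋0⦌) (v : H _⦋0⦌) :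
    H.map f.op (unit H) = H.map g.op v := by
  refine (map_map f (SimplexCategory.σ 0) _).trans ?_
  rw [vertex_eq v]
  exact congrArg (fun f : ⦋n⦌ ⟶ ⦋0⦌ => H.map f.op _) (Subsingleton.elim _ _)

variable (ρ ι) in
/-- A trivialization of a bundle over an edge `g` of the base which is the given identification of
the fibre at the last vertex; at the first vertex it differs from it by an automorphism `t`. Over
the degenerate edge the trivialization is required to be constant. -/
structure EdgeTrivialization (g : H _⦋1⦌) where
  a : M ⊗ Δ[1] ⟶ E
  isPullback : IsPullback a (snd M Δ[1]) ρ (SSet.yonedaEquiv.symm g)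
  t : Aut M
  a_zero : SSet.ι₀ ≫ a = t.hom ≫ ι
  a_one : SSet.ι₁ ≫ a = ι
  of_unit : g = unit H → a = fst M Δ[1] ≫ ι ∧ t = Iso.refl M

theorem nonempty_edgeTrivialization (hρ : IsFibreBundle M ρ) (hι : IsFibreInclusion ι ρ)
    (g : H _⦋1⦌) : Nonempty (EdgeTrivialization ρ ι g) := by
  by_cases hg : g = unit H
  · subst hg
    refine ⟨⟨fst M Δ[1] ≫ ι, ?_, Iso.refl M, rfl, rfl, fun _ => ⟨rfl, rfl⟩⟩⟩
    let v : Δ[0] ⟶ H := SSet.yonedaEquiv.symm (IsPartialMonoid.reduced (M := H)).choose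
    obtain ⟨p, hp⟩ := hι v
    obtain ⟨h0, h1, h2⟩ := isPullback_iff.1 hp
    have hv : ∀ (k : ℕ) (s : (Δ[0] : SSet.{u}) _⦋k⦌) (s' : (Δ[1] : SSet.{u}) _⦋k⦌),
        v.app _ s = (SSet.yonedaEquiv.symm (unit H)).app _ s' := fun k s s' =>
      (map_unit_eq (SSet.stdSimplex.objEquiv s') (SSet.stdSimplex.objEquiv s) _).symm
    refine isPullback_iff.2 ⟨?_, ?_, fun k x s hx => ?_⟩
    · rw [Category.assoc, h0]
      exact sset_hom_ext fun k m => hv k _ _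
    · rintro k ⟨m, s⟩ ⟨m', s'⟩ hm hs
      exact Prod.ext (h1 k m m' hm
        (SSet.stdSimplex.ext _ _ fun i => Subsingleton.elim (α := Fin 1) _ _)) hs
    · obtain ⟨m, hm, -⟩ := h2 k x (SSet.stdSimplex.objEquiv.symm
        ((⦋k⦌ : SimplexCategory).const ⦋0⦌ 0)) (hx.trans (hv k _ s).symm)
      exact ⟨(m, s), hm, rfl⟩
  · obtain ⟨a, ha⟩ := hρ.locallyTrivial 1 (SSet.yonedaEquiv.symm g)
    obtain ⟨τ₀, h₀⟩ := exists_aut_vertexIncl hι ha 0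
    obtain ⟨τ₁, h₁⟩ := exists_aut_vertexIncl hι ha 1
    have hτ : τ₁.hom ≫ τ₁.inv = 𝟙 M := Iso.hom_inv_id τ₁
    refine ⟨⟨τ₁.inv ▷ Δ[1] ≫ a, ?_, τ₀ * τ₁⁻¹, ?_, ?_, fun h => absurd h hg⟩⟩
    · refine IsPullback.of_iso ha (whiskerRightIso τ₁ Δ[1]) (Iso.refl _) (Iso.refl _) (Iso.refl _)
        ?_ ?_ (by simp) (by simp)
      · change a ≫ 𝟙 _ = τ₁.hom ▷ Δ[1] ≫ τ₁.inv ▷ Δ[1] ≫ a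
        rw [← comp_whiskerRight_assoc, hτ, id_whiskerRight, Category.id_comp, Category.comp_id]
      · change snd M Δ[1] ≫ 𝟙 _ = τ₁.hom ▷ Δ[1] ≫ snd M Δ[1]
        rw [whiskerRight_snd, Category.comp_id]
    · rw [← Category.assoc, SSet.ι₀_comp, Category.assoc]
      change τ₁.inv ≫ vertexIncl M 0 ≫ a = (τ₁.inv ≫ τ₀.hom) ≫ ι
      rw [Category.assoc, h₀]
    · rw [← Category.assoc, SSet.ι₁_comp, Category.assoc]
      change τ₁.inv ≫ vertexIncl M 1 ≫ a = ι
      rw [← h₁]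
      exact Iso.inv_hom_id_assoc τ₁ ι

/-- The edge `x ⋅ s(g)` over `g`, where `s(g)` is the image of the edge `(1, ι)` of `M × Δ[1]`.
Since the trivialization over `g` is `t` at the first vertex, this edge is the image of
`(t⁻¹(x), ι)`. -/
def edgeOf (S : ∀ g : H _⦋1⦌, EdgeTrivialization ρ ι g) (x : M _⦋1⦌) (g : H _⦋1⦌) : E _⦋1⦌ :=
  (S g).a.app (op ⦋1⦌) ((S g).t.inv.app _ x, SSet.stdSimplex.objEquiv.symm (𝟙 ⦋1⦌))

variable (S : ∀ g : H _⦋1⦌, EdgeTrivialization ρ ι g)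

theorem app_edgeOf (x : M _⦋1⦌) (g : H _⦋1⦌) : ρ.app _ (edgeOf S x g) = g := by
  refine (congrArg (fun f : M ⊗ Δ[1] ⟶ H => f.app (op ⦋1⦌) ((S g).t.inv.app _ x,
    SSet.stdSimplex.objEquiv.symm (𝟙 ⦋1⦌))) (S g).isPullback.w).trans ?_
  exact map_edge_one (e := 𝟙 _) rfl rfl

theorem edgeOf_injective {x x' : M _⦋1⦌} {g : H _⦋1⦌} (h : edgeOf S x g = edgeOf S x' g) :
    x = x' := by
  have h1 := congrArg Prod.fst ((isPullback_iff.1 (S g).isPullback).2.1 1 _ _ h rfl)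
  have h2 : ∀ z, (S g).t.hom.app (op ⦋1⦌) ((S g).t.inv.app (op ⦋1⦌) z) = z := fun z =>
    congrArg (fun f : M ⟶ M => f.app _ z) (Iso.inv_hom_id (S g).t)
  rw [← h2 x, ← h2 x']
  exact congrArg _ h1

theorem edgeOf_unit (x : M _⦋1⦌) : edgeOf S x (unit H) = ι.app _ x := by
  unfold edgeOf
  rw [((S (unit H)).of_unit rfl).1, ((S (unit H)).of_unit rfl).2]
  rfl

variable [PartialGroup M]

/-- A trivialization `a` of the bundle over a simplex `b`, together with its comparison with the
trivializations over the edges of `b`: `τ i` is the automorphism relating `a` at the vertex `i` to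
the given identification of the fibre, and the section over the edge `e` is `s(e) = a(u e, e)`. -/
structure LocalTrivialization {n : ℕ} (b : H _⦋n⦌) where
  a : M ⊗ Δ[n] ⟶ E
  isPullback : IsPullback a (snd M Δ[n]) ρ (SSet.yonedaEquiv.symm b)
  τ : Fin (n + 1) → Aut M
  u : (⦋1⦌ ⟶ ⦋n⦌) → Inner M
  aut_u : ∀ e, (u e).aut = (τ (src e))⁻¹ * (S (H.map e.op b)).t * τ (tgt e)
  a_edge : ∀ e x, edgeOf S x (H.map e.op b) =
    a.app (op ⦋1⦌) (Inner.bimul 1 (u e)⁻¹ ((τ (src e)).inv.app _ x),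
      SSet.stdSimplex.objEquiv.symm e)

/-- Over an edge `e` of `b`, the trivialization of that edge factors through the one over `b` by a
map `M × Δ[1] → M`. Normalized to be the identity at the last vertex, this map is the homotopy
that makes its value on `(1, ι)` an inner element `u e`. -/
theorem nonempty_localTrivialization (hρ : IsFibreBundle M ρ) (hι : IsFibreInclusion ι ρ)
    {n : ℕ} (b : H _⦋n⦌) : Nonempty (LocalTrivialization S b) := by
  obtain ⟨a, ha⟩ := hρ.locallyTrivial n (SSet.yonedaEquiv.symm b)
  choose τ hτ using fun i => exists_aut_vertexIncl hι ha i
  have key : ∀ e : ⦋1⦌ ⟶ ⦋n⦌, ∃ u : Inner M,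
      u.aut = (τ (src e))⁻¹ * (S (H.map e.op b)).t * τ (tgt e) ∧
      ∀ x, edgeOf S x (H.map e.op b) = a.app (op ⦋1⦌)
        (Inner.bimul 1 u⁻¹ ((τ (src e)).inv.app _ x), SSet.stdSimplex.objEquiv.symm e) := by
    intro e
    set g := H.map e.op b with hg
    have hw : (S g).a ≫ ρ = (snd M Δ[1] ≫ SSet.stdSimplex.map e) ≫ SSet.yonedaEquiv.symm b := by
      rw [(S g).isPullback.w, Category.assoc]
      refine congrArg (fun f => snd M Δ[1] ≫ f) (sset_hom_ext fun k s => ?_)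
      exact map_map _ _ _
    let κ : M ⊗ Δ[1] ⟶ M := ha.lift _ _ hw ≫ fst M Δ[n]
    have hκ : lift κ (snd M Δ[1] ≫ SSet.stdSimplex.map e) ≫ a = (S g).a := by
      rw [← ha.lift_fst _ _ hw]
      congr 1
      refine CartesianMonoidalCategory.hom_ext _ _ ?_ ?_
      · rw [lift_fst]
      · rw [lift_snd, ha.lift_snd]
    have hτs : (τ (src e)).hom ≫ (τ (src e)).inv = 𝟙 M := Iso.hom_inv_id _
    have hτt : (τ (tgt e)).hom ≫ (τ (tgt e)).inv = 𝟙 M := Iso.hom_inv_id _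
    have h₀ : SSet.ι₀ ≫ κ = (S g).t.hom ≫ (τ (src e)).inv := by
      rw [← Category.comp_id (SSet.ι₀ ≫ κ), ← hτs, ← Category.assoc]
      refine congrArg (· ≫ (τ (src e)).inv) (fibreInclusion_hom_ext hι ?_)
      rw [← (S g).a_zero, ← hκ, Category.assoc, hτ]
      rfl
    have h₁ : SSet.ι₁ ≫ κ = (τ (tgt e)).inv := by
      rw [← Category.comp_id (SSet.ι₁ ≫ κ), ← hτt, ← Category.assoc]
      refine (congrArg (· ≫ (τ (tgt e)).inv) (fibreInclusion_hom_ext (g := 𝟙 M) hι ?_)).trans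
        (Category.id_comp _)
      refine Eq.trans ?_ ((S g).a_one.trans (Category.id_comp ι).symm)
      rw [← hκ, Category.assoc, hτ]
      rfl
    have h₀' : SSet.ι₀ ≫ (τ (tgt e)).hom ▷ Δ[1] ≫ κ =
        ((τ (src e))⁻¹ * (S g).t * τ (tgt e)).hom := by
      rw [SSet.ι₀_comp_assoc, h₀]
      rfl
    have h₁' : SSet.ι₁ ≫ (τ (tgt e)).hom ▷ Δ[1] ≫ κ = 𝟙 M := by
      rw [SSet.ι₁_comp_assoc, h₁, hτt]
    let u : Inner M :=
      { el := ((τ (tgt e)).hom ▷ Δ[1] ≫ κ).app (op ⦋1⦌)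
          (unit M, SSet.stdSimplex.objEquiv.symm (𝟙 ⦋1⦌))
        aut := (τ (src e))⁻¹ * (S g).t * τ (tgt e)
        homotopy := ⟨_, h₀', h₁', rfl⟩ }
    refine ⟨u, rfl, fun x => ?_⟩
    -- the coordinate, in the trivialization over `b` at the last vertex, of `ι (t⁻¹ x)`
    let y := (τ (tgt e)).inv.app (op ⦋1⦌) ((S g).t.inv.app _ x)
    have hτt' : (τ (tgt e)).inv ≫ (τ (tgt e)).hom = 𝟙 M := Iso.inv_hom_id _
    have hy : (τ (tgt e)).hom.app (op ⦋1⦌) y = (S g).t.inv.app _ x :=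
      congrArg (fun f : M ⟶ M => f.app (op ⦋1⦌) ((S g).t.inv.app _ x)) hτt'
    have hty : (S g).t.hom.app (op ⦋1⦌) ((S g).t.inv.app _ x) = x :=
      congrArg (fun f : M ⟶ M => f.app (op ⦋1⦌) x) (Iso.inv_hom_id (S g).t)
    have h2 : κ.app (op ⦋1⦌) ((S g).t.inv.app _ x, SSet.stdSimplex.objEquiv.symm (𝟙 ⦋1⦌)) =
        Inner.bimul 1 u⁻¹ ((τ (src e)).inv.app _ x) := by
      have h3 : κ.app (op ⦋1⦌) ((τ (tgt e)).hom.app (op ⦋1⦌) y,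
          SSet.stdSimplex.objEquiv.symm (𝟙 ⦋1⦌)) = u.lmul y :=
        Inner.app_eq_lmul h₀' h₁' rfl y
      have h4 : u.aut.hom.app (op ⦋1⦌) y = (τ (src e)).inv.app _ x := by
        change (τ (src e)).inv.app _ ((S g).t.hom.app _ ((τ (tgt e)).hom.app _ y)) = _
        rw [hy, hty]
      rw [← hy, h3, ← h4, ← Inner.bimul_self, Inner.bimul_bimul, inv_mul_cancel, one_mul,
        Inner.bimul_one_right]
    refine Eq.trans ?_ (congrArg (fun z => a.app (op ⦋1⦌) (z, SSet.stdSimplex.objEquiv.symm e)) h2)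
    unfold edgeOf
    rw [← hκ]
    refine congrArg (fun s => a.app (op ⦋1⦌) (κ.app (op ⦋1⦌) ((S g).t.inv.app _ x,
      SSet.stdSimplex.objEquiv.symm (𝟙 ⦋1⦌)), s)) ?_
    ext k
    rfl
  choose u hu hu' using key
  exact ⟨⟨a, ha, τ, u, hu, hu'⟩⟩

end FibreBundle

/-! ### Extensions are twisted products -/

section Extension

variable {M H E : SSet.{u}} [PartialGroup H] [PartialGroup M] {ρ : E ⟶ H} {ι : M ⟶ E}

/-- The total space of an extension of partial groups is reduced. -/
theorem exists_vertex (hι : IsFibreInclusion ι ρ) : ∃ v : E _⦋0⦌, ∀ w : E _⦋0⦌, w = v := by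
  refine ⟨ι.app _ (IsPartialMonoid.reduced (M := M)).choose, fun w => ?_⟩
  obtain ⟨p, hp⟩ := hι (SSet.yonedaEquiv.symm (IsPartialMonoid.reduced (M := H)).choose)
  obtain ⟨m, rfl, -⟩ := (isPullback_iff.1 hp).2.2 0 w
    (SSet.stdSimplex.objEquiv.symm (𝟙 ⦋0⦌)) (vertex_eq _ _)
  rw [vertex_eq m]

variable {S : ∀ g : H _⦋1⦌, EdgeTrivialization ρ ι g}

namespace LocalTrivialization

variable {n : ℕ} {b : H _⦋n⦌} (L : LocalTrivialization S b)

/-- The simplex of the total space with coordinate `y` over the face `θ` of `b`. -/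
def point {m : ℕ} (y : M _⦋m⦌) (θ : ⦋m⦌ ⟶ ⦋n⦌) : E _⦋m⦌ :=
  L.a.app (op ⦋m⦌) (y, SSet.stdSimplex.objEquiv.symm θ)

theorem map_point {k m : ℕ} (y : M _⦋m⦌) (θ : ⦋m⦌ ⟶ ⦋n⦌) (f : ⦋k⦌ ⟶ ⦋m⦌) :
    E.map f.op (L.point y θ) = L.point (M.map f.op y) (f ≫ θ) := (map_app L.a f _).symm

theorem exists_point_eq {m : ℕ} {w : E _⦋m⦌} {θ : ⦋m⦌ ⟶ ⦋n⦌} (h : ρ.app _ w = H.map θ.op b) :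
    ∃ y, L.point y θ = w := by
  obtain ⟨⟨y, s⟩, hy, rfl⟩ := (isPullback_iff.1 L.isPullback).2.2 m w
    (SSet.stdSimplex.objEquiv.symm θ) h
  exact ⟨y, hy⟩

theorem app_point {m : ℕ} (y : M _⦋m⦌) (θ : ⦋m⦌ ⟶ ⦋n⦌) :
    ρ.app _ (L.point y θ) = H.map θ.op b :=
  congrArg (fun f : M ⊗ Δ[n] ⟶ H => f.app (op ⦋m⦌) (y, SSet.stdSimplex.objEquiv.symm θ))
    L.isPullback.w

theorem point_edge (x : M _⦋1⦌) (e : ⦋1⦌ ⟶ ⦋n⦌) : L.point x e =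
    edgeOf S ((L.τ (src e)).hom.app _ (Inner.bimul 1 (L.u e) x)) (H.map e.op b) := by
  have h : ∀ z, (L.τ (src e)).inv.app (op ⦋1⦌) ((L.τ (src e)).hom.app (op ⦋1⦌) z) = z := fun z =>
    congrArg (fun f : M ⟶ M => f.app _ z) (Iso.hom_inv_id (L.τ (src e)))
  rw [L.a_edge, h, Inner.bimul_bimul, mul_one, inv_mul_cancel, Inner.bimul_one]
  rfl

theorem map_point_edge {m : ℕ} (y : M _⦋m⦌) (θ : ⦋m⦌ ⟶ ⦋n⦌) (e : ⦋1⦌ ⟶ ⦋m⦌) :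
    E.map e.op (L.point y θ) = edgeOf S ((L.τ (src (e ≫ θ))).hom.app _
      (Inner.bimul 1 (L.u (e ≫ θ)) (M.map e.op y))) (H.map e.op (H.map θ.op b)) := by
  rw [map_point, point_edge, map_map]

/-- The element `η(g, h)` for the face `[g|h] = θ` of `b`, computed in the trivialization. -/
def twist (θ : ⦋2⦌ ⟶ ⦋n⦌) : Inner M :=
  L.τ (vert θ 0) • (L.u (SimplexCategory.mkOfSucc 0 ≫ θ) * L.u (SimplexCategory.mkOfSucc 1 ≫ θ) *
    (L.u (SimplexCategory.diag 2 ≫ θ))⁻¹)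

theorem aut_twist (θ : ⦋2⦌ ⟶ ⦋n⦌) : (L.twist θ).aut =
    (S (spine (H.map θ.op b) 0)).t * (S (spine (H.map θ.op b) 1)).t *
      (S (prodEdge (H.map θ.op b))).t⁻¹ := by
  rw [twist, Inner.smul_aut, Inner.mul_aut, Inner.mul_aut, Inner.inv_aut, L.aut_u, L.aut_u,
    L.aut_u, spine_map, spine_map, prodEdge_map]
  change L.τ (vert θ 0) * ((L.τ (vert θ 0))⁻¹ * _ * L.τ (vert θ 1) *
    ((L.τ (vert θ 1))⁻¹ * _ * L.τ (vert θ 2)) * ((L.τ (vert θ 0))⁻¹ * _ * L.τ (vert θ 2))⁻¹) *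
      (L.τ (vert θ 0))⁻¹ = _
  group

theorem coord_injective {e : ⦋1⦌ ⟶ ⦋n⦌} {x x' : M _⦋1⦌}
    (h : (L.τ (src e)).hom.app _ (Inner.bimul 1 (L.u e) x) =
      (L.τ (src e)).hom.app _ (Inner.bimul 1 (L.u e) x')) : x = x' := by
  have h1 := congrArg (fun z => Inner.bimul 1 (L.u e)⁻¹ ((L.τ (src e)).inv.app (op ⦋1⦌) z)) h
  have h2 : ∀ z, (L.τ (src e)).inv.app (op ⦋1⦌) ((L.τ (src e)).hom.app (op ⦋1⦌) z) = z := fun z =>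
    congrArg (fun f : M ⟶ M => f.app _ z) (Iso.hom_inv_id (L.τ (src e)))
  simpa only [h2, Inner.bimul_bimul, mul_one, inv_mul_cancel, Inner.bimul_one] using h1

theorem coord_u (e : ⦋1⦌ ⟶ ⦋n⦌) :
    (L.τ (src e)).hom.app _ (Inner.bimul 1 (L.u e) (L.u e).el) = unit M := by
  rw [Inner.bimul_el, mul_inv_cancel, Inner.one_el, app_unit]

/-- `s(g) ⋅ s(h) = η(g, h) ⋅ s(gh)`, where `s(g)` is the edge `edgeOf S 1 g`. -/
theorem prodEdge_eq_twist {θ : ⦋2⦌ ⟶ ⦋n⦌} {w : E _⦋2⦌} (hw : ρ.app _ w = H.map θ.op b)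
    (hs : ∀ i, spine w i = edgeOf S (unit M) (spine (H.map θ.op b) i)) :
    prodEdge w = edgeOf S (L.twist θ).el (prodEdge (H.map θ.op b)) := by
  obtain ⟨y, rfl⟩ := L.exists_point_eq hw
  have hy : ∀ i, spine y i = (L.u (SimplexCategory.mkOfSucc i ≫ θ)).el := fun i =>
    L.coord_injective ((edgeOf_injective S ((L.map_point_edge y θ _).symm.trans (hs i))).trans
      (L.coord_u _).symm)
  refine (L.map_point_edge y θ _).trans (congrArg (fun x => edgeOf S x _) ?_)
  have h : M.map (SimplexCategory.diag 2).op y = (L.u (SimplexCategory.mkOfSucc 0 ≫ θ) *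
      L.u (SimplexCategory.mkOfSucc 1 ≫ θ)).el := by
    refine HasProd.unique (by omega) ⟨y, ?_, rfl⟩ (Inner.hasProd_mul _ _)
    funext i
    rw [hy]
    fin_cases i <;> rfl
  rw [h, Inner.bimul_el]
  rfl

theorem exists_spine_eq (L : LocalTrivialization S b) (θ : ⦋2⦌ ⟶ ⦋n⦌) :
    ∃ w : E _⦋2⦌, ρ.app _ w = H.map θ.op b ∧
    ∀ i, spine w i = edgeOf S (unit M) (spine (H.map θ.op b) i) := by
  obtain ⟨y, hy, -⟩ := Inner.hasProd_mul (L.u (SimplexCategory.mkOfSucc 0 ≫ θ))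
    (L.u (SimplexCategory.mkOfSucc 1 ≫ θ))
  have hy' : ∀ i, spine y i = (L.u (SimplexCategory.mkOfSucc i ≫ θ)).el := fun i => by
    rw [hy]
    fin_cases i <;> rfl
  refine ⟨L.point y θ, L.app_point y θ, fun i => (L.map_point_edge y θ _).trans
    (congrArg (fun x => edgeOf S x _) ?_)⟩
  change (L.τ _).hom.app _ (Inner.bimul 1 _ (spine y i)) = _
  rw [hy', coord_u]

/-- The element `η(g, h)` does not depend on the trivialization used to compute it. -/
theorem twist_eq {m : ℕ} {c : H _⦋m⦌} (L' : LocalTrivialization S c) {θ : ⦋2⦌ ⟶ ⦋n⦌}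
    {θ' : ⦋2⦌ ⟶ ⦋m⦌} (h : H.map θ.op b = H.map θ'.op c) : L.twist θ = L'.twist θ' := by
  obtain ⟨w, hw, hs⟩ := L.exists_spine_eq θ
  have h1 := L.prodEdge_eq_twist hw hs
  have h2 := L'.prodEdge_eq_twist (hw.trans h) (h ▸ hs)
  rw [← h] at h2
  exact Inner.ext (edgeOf_injective S (h1.symm.trans h2))

theorem twist_eq_of_vert {θ : ⦋2⦌ ⟶ ⦋n⦌} {i : Fin (n + 1)} {e e' e'' : ⦋1⦌ ⟶ ⦋n⦌}
    (h : vert θ 0 = i) (he : SimplexCategory.mkOfSucc 0 ≫ θ = e)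
    (he' : SimplexCategory.mkOfSucc 1 ≫ θ = e') (he'' : SimplexCategory.diag 2 ≫ θ = e'') :
    L.twist θ = L.τ i • (L.u e * L.u e' * (L.u e'')⁻¹) := by
  rw [twist, h, he, he', he'']

theorem twist_cocycle {s : H _⦋3⦌} (L : LocalTrivialization S s) :
    (S (spine s 0)).t • L.twist (SimplexCategory.δ 0) * L.twist (SimplexCategory.δ 2) =
      L.twist (SimplexCategory.δ 3) * L.twist (SimplexCategory.δ 1) := by
  let e : ∀ i j : Fin 4, i ≤ j → (⦋1⦌ ⟶ ⦋3⦌) := fun i j h => SimplexCategory.mkOfLe i j h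
  rw [L.twist_eq_of_vert (θ := SimplexCategory.δ 0) (i := 1) (e := e 1 2 (by decide))
      (e' := e 2 3 (by decide)) (e'' := e 1 3 (by decide)) rfl (edge_hom_ext rfl rfl)
      (edge_hom_ext rfl rfl) (edge_hom_ext rfl rfl),
    L.twist_eq_of_vert (θ := SimplexCategory.δ 1) (i := 0) (e := e 0 2 (by decide))
      (e' := e 2 3 (by decide)) (e'' := e 0 3 (by decide)) rfl (edge_hom_ext rfl rfl)
      (edge_hom_ext rfl rfl) (edge_hom_ext rfl rfl),
    L.twist_eq_of_vert (θ := SimplexCategory.δ 2) (i := 0) (e := e 0 1 (by decide))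
      (e' := e 1 3 (by decide)) (e'' := e 0 3 (by decide)) rfl (edge_hom_ext rfl rfl)
      (edge_hom_ext rfl rfl) (edge_hom_ext rfl rfl),
    L.twist_eq_of_vert (θ := SimplexCategory.δ 3) (i := 0) (e := e 0 1 (by decide))
      (e' := e 1 2 (by decide)) (e'' := e 0 2 (by decide)) rfl (edge_hom_ext rfl rfl)
      (edge_hom_ext rfl rfl) (edge_hom_ext rfl rfl)]
  have h : (S (spine s 0)).t * L.τ 1 = L.τ 0 * (L.u (e 0 1 (by decide))).aut := by
    rw [L.aut_u]
    change _ = L.τ 0 * ((L.τ 0)⁻¹ * (S (spine s 0)).t * L.τ 1)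
    group
  rw [smul_smul, h, mul_smul, Inner.aut_smul, ← smul_mul', ← smul_mul']
  congr 1
  group

end LocalTrivialization

/-- The total space of an extension of partial groups is a partial monoid: simplices over the same
simplex of `H` are compared in a trivialization. -/
theorem isPartialMonoid_total (hι : IsFibreInclusion ι ρ)
    (L : ∀ (n : ℕ) (b : H _⦋n⦌), LocalTrivialization S b) : IsPartialMonoid E where
  reduced := exists_vertex hι
  spine_injective n hn w w' h := by
    have hb : ρ.app _ w' = ρ.app _ w := spine_ext hn fun i => by
      rw [spine_app, spine_app, congrFun h i]
    generalize hbw : ρ.app _ w = b at hb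
    have hid : b = H.map (𝟙 ⦋n⦌ : ⦋n⦌ ⟶ ⦋n⦌).op b := by rw [op_id, Functor.map_id_apply]
    obtain ⟨y, rfl⟩ := (L n b).exists_point_eq (hbw.trans hid)
    obtain ⟨y', rfl⟩ := (L n b).exists_point_eq (hb.trans hid)
    refine congrArg (fun y => (L n b).point y (𝟙 _)) (spine_ext hn fun i => ?_)
    exact (L n b).coord_injective (edgeOf_injective S (((L n b).map_point_edge y _ _).symm.trans
      ((congrFun h i).trans ((L n b).map_point_edge y' _ _))))

/-- The twisting pair of an extension: `t(g)` is the holonomy of the trivialization over `g`, and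
`η(g, h)` is determined by `s(g) ⋅ s(h) = η(g, h) ⋅ s(gh)`, where `s(g)` is the edge
`edgeOf S 1 g`. -/
def twistingPair [IsPartialMonoid E] (L : ∀ (n : ℕ) (b : H _⦋n⦌), LocalTrivialization S b) :
    TwistingPair H M where
  t g := (S g).t
  η s := ⟨((L 2 s).twist (𝟙 _)).el, _, ((L 2 s).twist (𝟙 _)).homotopy⟩
  homotopy s := by
    have h := ((L 2 s).twist (𝟙 _)).homotopy.precomp (S (prodEdge s)).t.hom
    rw [(L 2 s).aut_twist, op_id, Functor.map_id_apply] at h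
    rw [Category.comp_id] at h
    convert h using 1
    exact congrArg Iso.hom (inv_mul_cancel_right ((S (spine s 0)).t * (S (spine s 1)).t)
      (S (prodEdge s)).t).symm
  t_unit := ((S (unit H)).of_unit rfl).2
  η_unit s hs := by
    have hu : edgeOf S (unit M) (unit H) = unit E := by rw [edgeOf_unit, app_unit]
    have key : ∀ w : E _⦋2⦌, (∀ i, spine w i = edgeOf S (unit M) (spine s i)) →
        prodEdge w = edgeOf S (unit M) (prodEdge s) → ((L 2 s).twist (𝟙 _)).el = unit M := by
      intro w hw hp
      have h := (L 2 s).prodEdge_eq_twist (θ := 𝟙 _) (w := w)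
        (by
          rw [op_id, Functor.map_id_apply]
          exact spine_ext (by omega) fun i => by rw [spine_app, hw, app_edgeOf])
        (by rwa [op_id, Functor.map_id_apply])
      rw [op_id, Functor.map_id_apply, hp] at h
      exact (edgeOf_injective S h).symm
    rcases hs with hs | hs
    · obtain ⟨w, hw, hw'⟩ := hasProd_unit_left (edgeOf S (unit M) (spine s 1))
      have hp : prodEdge s = spine s 1 := by
        refine HasProd.unique (by omega) ⟨s, ?_, rfl⟩ (hasProd_unit_left _)
        funext i
        fin_cases i
        · exact hs
        · rfl
      refine key w (fun i => ?_) (by rw [hw', hp])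
      rw [hw]
      fin_cases i
      · exact (congrArg (edgeOf S (unit M)) hs).symm ▸ hu.symm
      · rfl
    · obtain ⟨w, hw, hw'⟩ := hasProd_unit_right (edgeOf S (unit M) (spine s 0))
      have hp : prodEdge s = spine s 0 := by
        refine HasProd.unique (by omega) ⟨s, ?_, rfl⟩ (hasProd_unit_right _)
        funext i
        fin_cases i
        · rfl
        · exact hs
      refine key w (fun i => ?_) (by rw [hw', hp])
      rw [hw]
      fin_cases i
      · rfl
      · exact (congrArg (edgeOf S (unit M)) hs).symm ▸ hu.symm
  cocycle s := by
    have hδ : ∀ i : Fin 4, (L 2 (H.δ i s)).twist (𝟙 _) = (L 3 s).twist (SimplexCategory.δ i) :=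
      fun i => (L 2 (H.δ i s)).twist_eq (L 3 s) (by
        rw [op_id, Functor.map_id_apply]
        rfl)
    simp only [hδ]
    refine ⟨_, Inner.hasProd_mul ((S (spine s 0)).t • (L 3 s).twist (SimplexCategory.δ 0)) _, ?_⟩
    rw [(L 3 s).twist_cocycle]
    exact Inner.hasProd_mul _ _

/-- The trivializations of an extension trivialize its twisting pair. -/
def LocalTrivialization.gauge [IsPartialMonoid E]
    (L : ∀ (n : ℕ) (b : H _⦋n⦌), LocalTrivialization S b) {n : ℕ} (b : H _⦋n⦌) :
    (twistingPair L).Gauge b where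
  τ := (L n b).τ
  u := (L n b).u
  aut_u := (L n b).aut_u
  inner_eq θ := by
    refine Inner.ext ?_
    change ((L 2 (H.map θ.op b)).twist (𝟙 _)).el = ((L n b).twist θ).el
    rw [(L 2 (H.map θ.op b)).twist_eq (L n b) (θ' := θ) (by rw [op_id, Functor.map_id_apply])]

/-- The isomorphism sends the edge `[(x, g)]` of the twisted product to
`x ⋅ s(g) = edgeOf S x g`. -/
theorem exists_product_iso [IsPartialMonoid E]
    (L : ∀ (n : ℕ) (b : H _⦋n⦌), LocalTrivialization S b) :
    ∃ f : (twistingPair L).product ≅ E,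
      (twistingPair L).incl ≫ f.hom = ι ∧ f.hom ≫ ρ = (twistingPair L).proj := by
  have := (twistingPair L).isPartialMonoid_product
  have hE : ∀ (n : ℕ) (b : H _⦋n⦌) (y : M _⦋n⦌) (e : ⦋1⦌ ⟶ ⦋n⦌),
      E.map e.op ((L n b).point y (𝟙 _)) =
        edgeOf S ((LocalTrivialization.gauge L b).fib y e) (H.map e.op b) := by
    intro n b y e
    rw [LocalTrivialization.map_point, LocalTrivialization.point_edge, Category.comp_id]
    rfl
  have hlabel : ∀ (n : ℕ) (z : (twistingPair L).Simplex ⦋n⦌) (e : ⦋1⦌ ⟶ ⦋n⦌),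
      (twistingPair L).label ((twistingPair L).product.map e.op z) =
        (z.fib e, H.map e.op z.base) := fun n z e =>
    Prod.ext (congrArg z.fib (Category.id_comp e)) rfl
  obtain ⟨F, hF⟩ := exists_hom_of_edges (X := E) (Z := (twistingPair L).product)
    (fun z => edgeOf S ((twistingPair L).label z).1 ((twistingPair L).label z).2) (by
      intro n z
      generalize hb : TwistingPair.Simplex.base z = b
      obtain ⟨y, rfl⟩ := (LocalTrivialization.gauge L b).exists_toSimplex_eq z hb
      refine ⟨(L n b).point y (𝟙 _), fun e => ?_⟩
      rw [hlabel]
      exact hE n _ y e)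
  have hFe : ∀ (n : ℕ) (z : (twistingPair L).Simplex ⦋n⦌) (e : ⦋1⦌ ⟶ ⦋n⦌),
      E.map e.op (F.app (op ⦋n⦌) z) = edgeOf S (z.fib e) (H.map e.op z.base) := fun n z e => by
    have h := hF ((twistingPair L).product.map e.op z)
    rw [hlabel] at h
    exact (map_app F e _).symm.trans h
  have hbij : ∀ n : ℕ, Function.Bijective (F.app (op ⦋n⦌)) := by
    refine fun n => ⟨fun z z' h => edge_ext fun e => (twistingPair L).label_bijective.1 ?_,
      fun w => ?_⟩
    · have he := (hFe n z e).symm.trans ((congrArg (E.map e.op) h).trans (hFe n z' e))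
      have hb := congrArg (fun x => ρ.app (op ⦋1⦌) x) he
      simp only [app_edgeOf] at hb
      rw [hb] at he
      refine (hlabel n z e).trans (Eq.trans ?_ (hlabel n z' e).symm)
      rw [hb, edgeOf_injective S he]
    · obtain ⟨y, hy⟩ := (L n (ρ.app _ w)).exists_point_eq (w := w) (θ := 𝟙 _)
        (by rw [op_id, Functor.map_id_apply])
      refine ⟨(LocalTrivialization.gauge L (ρ.app _ w)).toSimplex y, edge_ext fun e => ?_⟩
      rw [hFe, ← hy, hE, hy]
      rfl
  have : IsIso F := by
    refine (NatTrans.isIso_iff_isIso_app F).2 fun n => ?_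
    induction n using Opposite.rec with | _ n => ?_
    induction n using SimplexCategory.rec with | _ n => ?_
    exact (isIso_iff_bijective _).2 (hbij n)
  refine ⟨asIso F, hom_ext_edge fun x => ?_, hom_ext_edge fun z => ?_⟩
  · refine (hF _).trans (Eq.trans ?_ (edgeOf_unit S x))
    exact congrArg (fun p : M _⦋1⦌ × H _⦋1⦌ => edgeOf S p.1 p.2) ((twistingPair L).label_incl x)
  · exact (congrArg (fun x => ρ.app (op ⦋1⦌) x) (hF z)).trans (app_edgeOf S _ _)

theorem exists_twistingPair (hρ : IsFibreBundle M ρ) (hι : IsFibreInclusion ι ρ) :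
    ∃ (φ : TwistingPair H M) (f : φ.product ≅ E), φ.incl ≫ f.hom = ι ∧ f.hom ≫ ρ = φ.proj := by
  have S := fun g : H _⦋1⦌ => (nonempty_edgeTrivialization hρ hι g).some
  have L := fun (n : ℕ) (b : H _⦋n⦌) => (nonempty_localTrivialization S hρ hι b).some
  have := isPartialMonoid_total hι L
  exact ⟨twistingPair L, exists_product_iso L⟩

end Extension

end PartialGroups

end

theorem theorem4p4 (M H : SSet.{u}) [PartialGroup M] [PartialGroup H] :
    -- (a) every twisting pair defines a twisted product
    (∀ φ : TwistingPair H M,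
      -- it is an extension of `H` by `M`
      (IsFibreBundle M φ.proj ∧ IsFibreInclusion φ.incl φ.proj) ∧
      -- it is a partial group
      Nonempty (PartialGroup φ.product) ∧
      -- its elements are the pairs `(x, g)`, and the fibre inclusion is `x ↦ (x, 1)`
      Function.Bijective φ.label ∧
      (∀ x : M _⦋1⦌, φ.label (φ.incl.app _ x) = (x, unit H)) ∧
      -- the simplex `[(x_1,g_1)|…|(x_n,g_n)]` exists if and only if (i) and (ii) hold
      (∀ (n : ℕ) (x : Fin n → M _⦋1⦌) (g : Fin n → H _⦋1⦌),
        (∃ s : φ.product _⦋n⦌, ∀ i, φ.label (spine s i) = (x i, g i)) ↔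
          (IsSimplex g ∧ IsSimplex (φ.word g x))) ∧
      -- product formula
      (∀ (s : φ.product _⦋2⦌) (k : H _⦋2⦌) (x z : M _⦋1⦌) (g h : H _⦋1⦌),
        φ.label (spine s 0) = (x, g) → φ.label (spine s 1) = (z, h) → spine k = ![g, h] →
          HasProd ![x, φ.act g z, (φ.η k : M _⦋1⦌)] (φ.label (prodEdge s)).1 ∧
          HasProd ![g, h] (φ.label (prodEdge s)).2) ∧
      -- inverse formula
      (∀ (_ : PartialGroup φ.product) (s : φ.product _⦋1⦌) (k : H _⦋2⦌) (x : M _⦋1⦌)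
          (g : H _⦋1⦌),
        φ.label s = (x, g) → spine k = ![inverse g, g] →
          HasProd ![inverse (φ.η k : M _⦋1⦌), φ.act (inverse g) (inverse x)]
            (φ.label (inverse s)).1 ∧
          (φ.label (inverse s)).2 = inverse g) ∧
      -- the projection is `[(x_1,g_1)|…|(x_n,g_n)] ↦ [g_1|…|g_n]`
      (∀ (n : ℕ) (s : φ.product _⦋n⦌) (i : Fin n),
        spine (φ.proj.app _ s) i = (φ.label (spine s i)).2)) ∧
    -- (b) every extension of `H` by `M` is equivalent to a twisted product
    (∀ (E : SSet.{u}) (ρ : E ⟶ H), IsFibreBundle M ρ →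
      (∃ ι : M ⟶ E, IsFibreInclusion ι ρ) ∧
      ∀ ι : M ⟶ E, IsFibreInclusion ι ρ →
        ∃ (φ : TwistingPair H M) (e : φ.product ≅ E), φ.incl ≫ e.hom = ι ∧ e.hom ≫ ρ = φ.proj) ∧
    -- the total space of an extension is a partial group
    (∀ (E : SSet.{u}) (ρ : E ⟶ H), IsFibreBundle M ρ → Nonempty (PartialGroup E)) := by
  refine ⟨fun φ => ⟨⟨φ.isFibreBundle_proj, φ.isFibreInclusion_incl⟩, φ.nonempty_partialGroup,
    φ.label_bijective, φ.label_incl, fun n x g => φ.exists_spine_iff x g, ?_, ?_,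
    fun n s i => spine_app φ.proj s i⟩, fun E ρ hρ => ⟨exists_isFibreInclusion hρ,
      fun ι hι => exists_twistingPair hρ hι⟩, fun E ρ hρ => ?_⟩
  · intro s k x z g h h0 h1 hk
    have hs := φ.label_hasProd s
    have hb := φ.base_hasProd s
    rw [h0, h1] at hs hb
    have hbase : TwistingPair.Simplex.base s = k := by
      refine spine_ext (by omega) fun i => ?_
      rw [hk]
      fin_cases i
      · exact congrArg Prod.snd h0
      · exact congrArg Prod.snd h1
    rw [hbase] at hs
    exact ⟨hs, hb⟩
  · intro _ s k x g hs hk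
    have h := φ.label_of_hasProd_unit (hasProd_inverse_left s) (k := k) (by rw [hs, hk])
    rw [hs] at h
    exact h.symm
  · obtain ⟨ι, hι⟩ := exists_isFibreInclusion hρ
    obtain ⟨φ, f, -⟩ := exists_twistingPair hρ hι
    obtain ⟨_⟩ := φ.nonempty_partialGroup
    exact nonempty_partialGroup_of_iso f
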